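/- Let $(V,g)$ be a finite-dimensional real vector space with a positive definite inner product, and let \[\mathcal T(V)=\{K\in \mathrm{End}\,V : K^2=-1,\ g(K\cdot,K\cdot)=g(\cdot,\cdot)\},\] a submanifold of $\mathrm{End}\,V$ with tangent spaces $T_K\mathcal T(V)=\mathfrak o_{\{K\}}=\{A\in\mathfrak o(V,g) : AK+KA=0\}$ and complex structure $I_{\mathcal T}A=KA$ for $A\in T_K\mathcal T(V)$. For a field of endomorphisms $F\colon K\mapsto F|_K\in\mathrm{End}\,V$ on $\mathcal T(V)$ let $\mathcal D^F$ be the (possibly singular) distribution \[\mathcal D^F|_K=\{B\in\mathfrak o_{\{K\}} : B(\mathrm{Ker}\,F|_K)=0,\ B(\mathrm{Im}\,F|_K)\subseteq \mathrm{Im}\,F|_K\}.\] Fix $J\in\mathcal T(V)$ and write $\phi|_K=K$. Let $S\in\{\mathbb 1,\ J+\phi,\ J-\phi,\ [J,\phi]\}$ and let $Q=a_k\{J,\phi\}^k+\dots+a_1\{J,\phi\}+a_0\mathbb 1$, where $\{A,B\}=AB+BA$ and $a_0,\dots,a_k\in C^\infty(\mathcal T(V))$. Suppose that $da_i(B)=0$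 for all $i$, all $L\in\mathcal T(V)$ and all $B\in\mathcal D^{S}|_L$. Let $K\in\mathcal T(V)$. With respect to the orthogonal, $K$-invariant splitting $V=\mathrm{Ker}\,QS|_K\oplus\mathrm{Im}\,QS|_K$ write $K=K^a\oplus K^b$, and put \[\mathcal T^{QS}_K=\{K'=K^a\oplus K'^b : K'^b\in\mathcal T(\mathrm{Im}\,QS|_K),\ \mathrm{Im}\,QS|_{K'}=\mathrm{Im}\,QS|_K\}.\] Then the connected component of $\mathcal T^{QS}_K$ that contains $K$ is the leaf of $\mathcal D^{QS}$ through $K$, i.e. it is a connected immersed integral manifold of $\mathcal D^{QS}$ that contains $K$ and contains every connected immersed integral manifold of $\mathcal D^{QS}$ that meets it. Moreover, it is an embedded complex submanifold of $(\mathcal T(V),I_{\mathcal T})$. -/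

import Mathlib

open scoped Manifold ContDiff InnerProductSpace

universe u

namespace Twistor

noncomputable section

section Algebra

variable {V : Type u} [NormedAddCommGroup V] [InnerProductSpace ℝ V]

/-- The twistor space `T(V)`: orthogonal complex structures on `V`, as a subset of `End V`. -/
def twistorSpace (V : Type u) [NormedAddCommGroup V] [InnerProductSpace ℝ V] :
    Set (V →L[ℝ] V) :=
  {J | J * J = -1 ∧ ∀ x y : V, ⟪J x, J y⟫_ℝ = ⟪x, y⟫_ℝ}

/-- The tangent space of `T(V)` at `K`, as a subspace of `End V`: the skew-symmetric
endomorphisms that anticommute with `K`. -/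
def skewAnti (K : V →L[ℝ] V) : Submodule ℝ (V →L[ℝ] V) where
  carrier := {A | (∀ x y : V, ⟪A x, y⟫_ℝ = -⟪x, A y⟫_ℝ) ∧ A * K + K * A = 0}
  zero_mem' := by simp
  add_mem' := by
    rintro A B ⟨hA, hA'⟩ ⟨hB, hB'⟩
    refine ⟨fun x y => ?_, ?_⟩
    · simp only [add_apply, inner_add_left, inner_add_right, hA, hB]
      ring
    · calc (A + B) * K + K * (A + B) = (A * K + K * A) + (B * K + K * B) := by noncomm_ring
        _ = 0 := by rw [hA', hB', add_zero]
  smul_mem' := by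
    rintro c A ⟨hA, hA'⟩
    refine ⟨fun x y => ?_, ?_⟩
    · simp [real_inner_smul_left, real_inner_smul_right, hA]
    · rw [smul_mul_assoc, mul_smul_comm, ← smul_add, hA', smul_zero]

/-- The almost complex structure `I_T A = K A` for `A` tangent to `T(V)` at `K`. -/
def almostComplex (K A : V →L[ℝ] V) : V →L[ℝ] V := K * A

/-- The distribution `D^F` of a field of endomorphisms `F`: at `K` it consists of the tangent
vectors of `T(V)` at `K` that vanish on `Ker F|_K` and map `Im F|_K` to itself. -/
def distribution (F : (V →L[ℝ] V) → (V →L[ℝ] V)) (K : V →L[ℝ] V) :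
    Submodule ℝ (V →L[ℝ] V) where
  carrier := {B | B ∈ skewAnti K ∧ (∀ x : V, F K x = 0 → B x = 0) ∧
    ∀ x ∈ (F K).range, B x ∈ (F K).range}
  zero_mem' := ⟨Submodule.zero_mem _, fun _ _ => rfl, fun _ _ => Submodule.zero_mem _⟩
  add_mem' := by
    rintro A B ⟨hA, hA', hA''⟩ ⟨hB, hB', hB''⟩
    exact ⟨Submodule.add_mem _ hA hB, fun x hx => by simp [hA' x hx, hB' x hx],
      fun x hx => Submodule.add_mem _ (hA'' x hx) (hB'' x hx)⟩
  smul_mem' := by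
    rintro c A ⟨hA, hA', hA''⟩
    exact ⟨Submodule.smul_mem _ c hA, fun x hx => by simp [hA' x hx],
      fun x hx => Submodule.smul_mem _ c (hA'' x hx)⟩

/-- The four admissible fields `1`, `J + φ`, `J - φ`, `[J, φ]`, where `φ|_K = K`. -/
def admissibleS (J : V →L[ℝ] V) : Set ((V →L[ℝ] V) → (V →L[ℝ] V)) :=
  {fun _ => 1, fun K => J + K, fun K => J - K, fun K => J * K - K * J}

/-- `Q = a_k {J, φ}^k + ... + a_1 {J, φ} + a_0 1`, where `φ|_K = K`. -/
def polyQ (J : V →L[ℝ] V) {k : ℕ} (a : Fin (k + 1) → (V →L[ℝ] V) → ℝ) (K : V →L[ℝ] V) :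
    V →L[ℝ] V :=
  ∑ i : Fin (k + 1), a i K • (J * K + K * J) ^ (i : ℕ)

/-- `T^F_K`: all `K' = K^a ⊕ K'^b` with respect to `V = Ker F|_K ⊕ Im F|_K`, where `K^a` is the
restriction of `K` to the kernel, `K'^b` is in the twistor space of the image, and
`Im F|_{K'} = Im F|_K`. -/
def leafSet (F : (V →L[ℝ] V) → (V →L[ℝ] V)) (K : V →L[ℝ] V) : Set (V →L[ℝ] V) :=
  {K' | (∀ x : V, F K x = 0 → K' x = K x) ∧
    (∃ L ∈ twistorSpace (F K).range, ∀ x : (F K).range, K' x = L x) ∧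
    (F K').range = (F K).range}

/-- `X` is a (smooth, embedded) complex submanifold of `T(V)` with its complex structure `I_T`:
it is covered by relatively open pieces, each the homeomorphic image of an open set of some `ℂ^k`
under a smooth immersion `f` that is holomorphic, i.e. `df (i v) = I_T (df v)`. -/
def IsComplexSubmanifold (X : Set (V →L[ℝ] V)) : Prop :=
  X ⊆ twistorSpace V ∧
  ∀ p ∈ X, ∃ (k : ℕ) (U : Set (EuclideanSpace ℂ (Fin k)))
    (f : EuclideanSpace ℂ (Fin k) → (V →L[ℝ] V)),
    IsOpen U ∧ p ∈ f '' U ∧ ContDiffOn ℝ ∞ f U ∧ Set.InjOn f U ∧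
    (∀ U' ⊆ U, IsOpen U' → ∃ O : Set (V →L[ℝ] V), IsOpen O ∧ f '' U' = X ∩ O) ∧
    ∀ z ∈ U, Function.Injective (fderiv ℝ f z) ∧
      ∀ v, fderiv ℝ f z (Complex.I • v) = almostComplex (f z) (fderiv ℝ f z v)

end Algebra

section Leaves

variable {E : Type u} [NormedAddCommGroup E] [NormedSpace ℝ E]

/-- `Y` is a connected integral manifold, inside `M ⊆ E`, of the (possibly singular) distribution
`D`: it is the image of a connected, Hausdorff, second countable smooth manifold under an injective
immersion whose differential has image `D` at every point. -/
def IsConnectedIntegralManifold (M : Set E) (D : E → Submodule ℝ E) (Y : Set E) : Prop :=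
  Y ⊆ M ∧
  ∃ (d : ℕ) (N : Type u) (_ : TopologicalSpace N) (_ : ChartedSpace (EuclideanSpace ℝ (Fin d)) N)
    (ι : N → E),
    IsManifold (𝓡 d) ∞ N ∧ T2Space N ∧ SecondCountableTopology N ∧ ConnectedSpace N ∧
    ContMDiff (𝓡 d) 𝓘(ℝ, E) ∞ ι ∧ Function.Injective ι ∧ Set.range ι = Y ∧
    ∀ x : N, Function.Injective (mfderiv (𝓡 d) 𝓘(ℝ, E) ι x) ∧
      Set.range (mfderiv (𝓡 d) 𝓘(ℝ, E) ι x) = (D (ι x) : Set E)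

/-- `X` is the leaf of `D` through `p`: the maximal connected integral manifold containing `p`. -/
structure IsLeaf (M : Set E) (D : E → Submodule ℝ E) (p : E) (X : Set E) : Prop where
  integral : IsConnectedIntegralManifold M D X
  mem : p ∈ X
  maximal : ∀ Y : Set E, IsConnectedIntegralManifold M D Y → (X ∩ Y).Nonempty → Y ⊆ X

end Leaves

end

end Twistor

/-!
Conjugation by `1 + A` with `A ∈ skewAnti p`, the Cayley transform, parametrises the orthogonal
complex structures near `p`. If `A` vanishes on `Ker F|_p`, the transform changes `p` on `Im F|_p`
only, so these conjugates sweep out a neighbourhood of `p` in `T^F_p` as soon as they leave the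
kernel of `F` unchanged. For `F = Q S` with constant coefficients this holds by semicontinuity of
the rank, because `F` at `x` acts on a `J`- and `x`-invariant subspace only through the restrictions
of `J` and `x`. Variable coefficients are constant along curves tangent to `D^{QS} ⊆ D^S`, so they
may be frozen. The differential of the Cayley transform is linear over `I_T`, which makes the charts
holomorphic.

For maximality, freeze the coefficients along an integral manifold. The dimension of the
distribution is constant there, and forces the rank of `F` to be constant unless the distribution
vanishes. Tangent vectors kill `Ker F`, so the derivative of `F` kills it too, and a linear
differential inequality shows that the kernel does not move. Hence the integral manifold stays
locally in `T^F`, and connectedness gives the rest.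
-/

namespace Twistor

noncomputable section

open Filter Module Set
open scoped Topology Ring

section KernelPerturbation

variable {E F H : Type*} [NormedAddCommGroup E] [NormedSpace ℝ E]
  [NormedAddCommGroup F] [NormedSpace ℝ F] [NormedAddCommGroup H] [NormedSpace ℝ H]

theorem exists_eventually_le_norm_apply [FiniteDimensional ℝ E] {W : Submodule ℝ E} {R : E →L[ℝ] F}
    (hR : Disjoint W R.ker) : ∃ c > 0, ∀ᶠ R' in 𝓝 R, ∀ w ∈ W, c * ‖w‖ ≤ ‖R' w‖ := by
  obtain ⟨K, hK, hanti⟩ := LinearMap.exists_antilipschitzWith ((R : E →ₗ[ℝ] F).domRestrict W)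
    (LinearMap.ker_eq_bot.2 (LinearMap.injective_domRestrict_iff.2 hR))
  have hK : (0 : ℝ) < K := hK
  refine ⟨(K : ℝ)⁻¹ / 2, by positivity, ?_⟩
  filter_upwards [Metric.closedBall_mem_nhds R (show 0 < (K : ℝ)⁻¹ / 2 by positivity)]
    with R' hR' w hw
  have hRw : (K : ℝ)⁻¹ * ‖w‖ ≤ ‖R w‖ := by
    rw [inv_mul_le_iff₀ hK]
    exact ZeroHomClass.bound_of_antilipschitz _ hanti (⟨w, hw⟩ : W)
  have hsub : ‖(R' - R) w‖ ≤ (K : ℝ)⁻¹ / 2 * ‖w‖ :=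
    (R' - R).le_of_opNorm_le (by simpa [dist_eq_norm] using hR') w
  have htri : ‖R w‖ ≤ ‖R' w‖ + ‖(R' - R) w‖ := by
    simpa using norm_sub_le (R' w) ((R' - R) w)
  linarith

theorem disjoint_ker_of_le_norm_apply {W : Submodule ℝ E} {R : E →L[ℝ] F} {c : ℝ} (hc : 0 < c)
    (h : ∀ w ∈ W, c * ‖w‖ ≤ ‖R w‖) : Disjoint W R.ker := by
  refine Submodule.disjoint_def.2 fun w hw hRw => norm_le_zero_iff.1 ?_
  have hcw := h w hw
  rw [show R w = 0 from hRw, norm_zero] at hcw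
  exact nonpos_of_mul_nonpos_right hcw hc

theorem eventually_ker_eq_of_ker_le [FiniteDimensional ℝ E] (R : E →L[ℝ] F) :
    ∀ᶠ R' in 𝓝 R, R.ker ≤ R'.ker → R'.ker = R.ker := by
  obtain ⟨W, hW⟩ := R.ker.exists_isCompl
  obtain ⟨c, hc, hbound⟩ := exists_eventually_le_norm_apply hW.symm.disjoint
  filter_upwards [hbound] with R' hR' hle
  refine (eq_of_le_of_inf_le_of_sup_le hle (z := W) ?_ ?_).symm
  · rw [(disjoint_ker_of_le_norm_apply hc hR').symm.eq_bot]
    exact bot_le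
  · rw [hW.sup_eq_top]
    exact le_top

theorem apply_eq_zero_of_hasDerivWithinAt {R R' : ℝ → E →L[ℝ] F} {U : Submodule ℝ E} {b δ : ℝ}
    (hδ : 0 < δ) (hR : ∀ t ∈ Icc (0 : ℝ) 1, HasDerivWithinAt R (R' t) (Icc 0 1) t)
    (hb : ∀ t ∈ Icc (0 : ℝ) 1, ‖R' t‖ ≤ b)
    (hker : ∀ t ∈ Icc (0 : ℝ) 1, ∀ v, R t v = 0 → R' t v = 0)
    (hU : ∀ t ∈ Icc (0 : ℝ) 1, (R t).ker ⊔ U = ⊤)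
    (hRU : ∀ t ∈ Icc (0 : ℝ) 1, ∀ w ∈ U, δ * ‖w‖ ≤ ‖R t w‖) {v : E} (hv : R 0 v = 0) :
    R 1 v = 0 := by
  have hderiv : ∀ t ∈ Icc (0 : ℝ) 1, HasDerivWithinAt (fun s => R s v) (R' t v) (Icc 0 1) t :=
    fun t ht => by simpa using (hR t ht).clm_apply (hasDerivWithinAt_const t (Icc (0 : ℝ) 1) v)
  refine eq_zero_of_abs_deriv_le_mul_abs_self_of_eq_zero_right (K := b / δ)
    (fun t ht => (hderiv t ht).continuousWithinAt)
    (fun t ht => (hderiv t (Ico_subset_Icc_self ht)).mono_of_mem_nhdsWithin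
      (Icc_mem_nhdsGE_of_mem ht)) hv (fun t ht => ?_) 1 (right_mem_Icc.2 zero_le_one)
  replace ht := Ico_subset_Icc_self ht
  obtain ⟨z, hz, w, hw, rfl⟩ := Submodule.mem_sup.1 (hU t ht ▸ Submodule.mem_top (x := v))
  have hRz : R t z = 0 := hz
  rw [map_add, map_add, hker t ht z hRz, hRz, zero_add, zero_add]
  calc ‖R' t w‖ ≤ b * ‖w‖ := (R' t).le_of_opNorm_le (hb t ht) w
    _ = b / δ * (δ * ‖w‖) := by field_simp
    _ ≤ b / δ * ‖R t w‖ := by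
      have := (norm_nonneg _).trans (hb t ht)
      gcongr
      exact hRU t ht w hw

theorem eventually_ker_eq [FiniteDimensional ℝ E] {R : H → E →L[ℝ] F} {u₀ : H}
    (hR : ContDiffAt ℝ 1 R u₀)
    (hker : ∀ᶠ u in 𝓝 u₀, ∀ w v, R u v = 0 → fderiv ℝ R u w v = 0)
    (hfin : ∀ᶠ u in 𝓝 u₀, finrank ℝ (R u).ker = finrank ℝ (R u₀).ker) :
    ∀ᶠ u in 𝓝 u₀, (R u).ker = (R u₀).ker := by
  obtain ⟨U, hU⟩ := (R u₀).ker.exists_isCompl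
  obtain ⟨δ, hδ, hbound⟩ := exists_eventually_le_norm_apply hU.symm.disjoint
  have hdiff : ∀ᶠ u in 𝓝 u₀, DifferentiableAt ℝ R u :=
    (hR.eventually (by simp)).mono fun u hu => hu.differentiableAt one_ne_zero
  have hfderiv : ∀ᶠ u in 𝓝 u₀, ‖fderiv ℝ R u‖ < ‖fderiv ℝ R u₀‖ + 1 :=
    (hR.continuousAt_fderiv one_ne_zero).norm.eventually_lt_const (lt_add_one _)
  obtain ⟨ε, hε, hball⟩ := Metric.eventually_nhds_iff_ball.1
    (((hR.continuousAt.eventually hbound).and hdiff).and (hfderiv.and (hker.and hfin)))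
  filter_upwards [Metric.ball_mem_nhds u₀ hε] with u hu
  refine (Submodule.eq_of_le_of_finrank_eq (fun v hv => ?_) (hball u hu).2.2.2.symm).symm
  let γ : ℝ → H := AffineMap.lineMap u₀ u
  have hγ : ∀ t ∈ Icc (0 : ℝ) 1, γ t ∈ Metric.ball u₀ ε := fun t ht =>
    (convex_ball u₀ ε).lineMap_mem (Metric.mem_ball_self hε) hu ht
  have hRγ : ∀ t ∈ Icc (0 : ℝ) 1,
      HasDerivWithinAt (R ∘ γ) (fderiv ℝ R (γ t) (u - u₀)) (Icc 0 1) t := fun t ht =>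
    (hball _ (hγ t ht)).1.2.hasFDerivAt.comp_hasDerivWithinAt t AffineMap.hasDerivWithinAt_lineMap
  have hγ1 : (R ∘ γ) 1 v = 0 := by
    refine apply_eq_zero_of_hasDerivWithinAt (U := U) hδ hRγ
      (b := (‖fderiv ℝ R u₀‖ + 1) * ‖u - u₀‖) (fun t ht => ?_)
      (fun t ht => (hball _ (hγ t ht)).2.2.1 _) (fun t ht => ?_)
      (fun t ht => (hball _ (hγ t ht)).1.1) (by simpa [γ] using hv)
    · exact ContinuousLinearMap.le_of_opNorm_le _ (hball _ (hγ t ht)).2.1.le _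
    · obtain ⟨⟨hle, -⟩, -, -, hdim⟩ := hball _ (hγ t ht)
      refine Submodule.eq_top_of_disjoint _ _ ?_ (disjoint_ker_of_le_norm_apply hδ hle).symm
      exact (hdim.symm ▸ Submodule.finrank_add_eq_of_isCompl hU).ge
  simpa [γ] using hγ1

theorem eq_of_fderivWithin_eq_zero {T : Set E} {D : E → Submodule ℝ E} {a : E → F}
    (ha : DifferentiableOn ℝ a T) (hD : ∀ x ∈ T, ∀ B ∈ D x, fderivWithin ℝ a T x B = 0)
    {h : H → E} {h' : H → H →L[ℝ] E} {U : Set H} (hU : IsOpen U) (hU' : IsPreconnected U)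
    (hh : ∀ u ∈ U, HasFDerivAt h (h' u) u) (hT : ∀ u ∈ U, h u ∈ T)
    (hh' : ∀ u ∈ U, ∀ w, h' u w ∈ D (h u)) {u v : H} (hu : u ∈ U) (hv : v ∈ U) :
    a (h u) = a (h v) := by
  have hcomp : ∀ u ∈ U, HasFDerivAt (a ∘ h) (0 : H →L[ℝ] F) u := by
    intro u hu
    have hzero : (fderivWithin ℝ a T (h u)).comp (h' u) = 0 :=
      ContinuousLinearMap.ext fun w =>
        hD (h u) (hT u hu) (h' u w) (hh' u hu w)
    have hchain := (ha _ (hT u hu)).hasFDerivWithinAt.comp_hasFDerivAt u (hh u hu)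
      (mem_of_superset (hU.mem_nhds hu) hT)
    rwa [hzero] at hchain
  exact hU.is_const_of_fderiv_eq_zero hU'
    (fun u hu => (hcomp u hu).differentiableAt.differentiableWithinAt)
    (fun u hu => (hcomp u hu).fderiv) hu hv

end KernelPerturbation

section TwistorAlgebra

open InnerProductSpace

variable {V : Type u} [NormedAddCommGroup V] [InnerProductSpace ℝ V]

/-- The endomorphisms in `skewAnti p` that vanish on `M`. For `M = Ker F|_p` and a field `F` whose
kernel and image are orthogonal complements, this is the distribution `D^F` at `p`. -/
def skewAntiOn (M : Submodule ℝ V) (p : V →L[ℝ] V) : Submodule ℝ (V →L[ℝ] V) where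
  carrier := {B | B ∈ skewAnti p ∧ ∀ v ∈ M, B v = 0}
  zero_mem' := ⟨Submodule.zero_mem _, fun _ _ => rfl⟩
  add_mem' := by
    rintro A B ⟨hA, hA'⟩ ⟨hB, hB'⟩
    exact ⟨Submodule.add_mem _ hA hB, fun x hx => by simp [hA' x hx, hB' x hx]⟩
  smul_mem' := by
    rintro c A ⟨hA, hA'⟩
    exact ⟨Submodule.smul_mem _ c hA, fun x hx => by simp [hA' x hx]⟩

variable {M N : Submodule ℝ V} {p x A B C : V →L[ℝ] V}

theorem apply_mem_orthogonal_of_mem_skewAntiOn (hB : B ∈ skewAntiOn M p) (v : V) : B v ∈ Mᗮ := by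
  rw [Submodule.mem_orthogonal']
  intro m hm
  rw [hB.1.1 v m, hB.2 m hm, inner_zero_right, neg_zero]

theorem apply_apply_of_mem_skewAnti (hA : A ∈ skewAnti p) (v : V) : A (p v) = -p (A v) := by
  have h := add_eq_zero_iff_eq_neg.1 hA.2
  simpa using congr($h v)

theorem apply_apply_of_mem_twistorSpace (hp : p ∈ twistorSpace V) (v : V) : p (p v) = -v := by
  simpa using congr($(hp.1) v)

theorem inner_apply_of_mem_twistorSpace (hp : p ∈ twistorSpace V) (v w : V) :
    ⟪p v, w⟫_ℝ = -⟪v, p w⟫_ℝ := by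
  rw [← hp.2 v (p w), apply_apply_of_mem_twistorSpace hp, inner_neg_right, neg_neg]

theorem apply_mem_orthogonal_of_mem_twistorSpace (hp : p ∈ twistorSpace V)
    (hM : ∀ v ∈ M, p v ∈ M) {v : V} (hv : v ∈ Mᗮ) : p v ∈ Mᗮ := by
  rw [Submodule.mem_orthogonal'] at hv ⊢
  intro m hm
  rw [inner_apply_of_mem_twistorSpace hp, hv _ (hM m hm), neg_zero]

/-- The anti-linear part, with respect to `x`, of the rotation generator `w ∧ u`; the simplest
elements of `skewAnti x`. -/
def antiWedge (x : V →L[ℝ] V) (w u : V) : V →L[ℝ] V :=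
  rankOne ℝ u w - rankOne ℝ w u - rankOne ℝ (x u) (x w) + rankOne ℝ (x w) (x u)

theorem antiWedge_apply (w u v : V) :
    antiWedge x w u v = ⟪w, v⟫_ℝ • u - ⟪u, v⟫_ℝ • w - ⟪x w, v⟫_ℝ • x u + ⟪x u, v⟫_ℝ • x w := rfl

theorem antiWedge_mem_skewAntiOn (hx : x ∈ twistorSpace V) (hM : ∀ v ∈ M, x v ∈ M) {w u : V}
    (hw : w ∈ Mᗮ) (hu : u ∈ Mᗮ) : antiWedge x w u ∈ skewAntiOn M x := by
  refine ⟨⟨fun y z => ?_, ?_⟩, fun v hv => ?_⟩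
  · simp only [antiWedge_apply, inner_add_left, inner_sub_left, real_inner_smul_left,
      real_inner_comm _ y]
    ring
  · ext v
    have hx' : ∀ a, ⟪a, x v⟫_ℝ = -⟪x a, v⟫_ℝ := fun a => by
      rw [inner_apply_of_mem_twistorSpace hx, neg_neg]
    simp only [add_apply, mul_apply_eq_comp, antiWedge_apply, hx', map_add, map_sub, map_smul,
      apply_apply_of_mem_twistorSpace hx, inner_neg_left, zero_apply]
    module
  · simp only [antiWedge_apply, Submodule.inner_left_of_mem_orthogonal hv hw,
      Submodule.inner_left_of_mem_orthogonal hv hu,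
      Submodule.inner_left_of_mem_orthogonal hv (apply_mem_orthogonal_of_mem_twistorSpace hx hM hu),
      Submodule.inner_left_of_mem_orthogonal hv (apply_mem_orthogonal_of_mem_twistorSpace hx hM hw),
      zero_smul, sub_zero, add_zero]

theorem eq_zero_of_forall_skewAntiOn_apply_eq_zero (hx : x ∈ twistorSpace V)
    (hM : ∀ v ∈ M, x v ∈ M) (hne : skewAntiOn M x ≠ ⊥) {u : V} (hu : u ∈ Mᗮ)
    (hzero : ∀ B ∈ skewAntiOn M x, B u = 0) : u = 0 := by
  obtain ⟨B, hB, hB0⟩ := Submodule.exists_mem_ne_zero_of_ne_bot hne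
  obtain ⟨v, hv⟩ := DFunLike.ne_iff.1 hB0
  have hwu : ⟪B v, u⟫_ℝ = 0 := by rw [hB.1.1, hzero B hB, inner_zero_right, neg_zero]
  have hxwu : ⟪x (B v), u⟫_ℝ = 0 := by
    rw [inner_apply_of_mem_twistorSpace hx, hB.1.1, apply_apply_of_mem_skewAnti hB.1, hzero B hB,
      map_zero, neg_zero, inner_zero_right, neg_zero, neg_zero]
  have hxu : ⟪x u, u⟫_ℝ = 0 := by
    have := inner_apply_of_mem_twistorSpace hx u u
    rw [real_inner_comm (x u) u] at this
    linarith
  have h := hzero _ (antiWedge_mem_skewAntiOn hx hM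
    (apply_mem_orthogonal_of_mem_skewAntiOn hB v) hu)
  rw [antiWedge_apply, hwu, hxwu, hxu] at h
  simpa [show B v ≠ 0 from hv] using h

theorem one_sub_mul_mul_comm (hp : p ∈ twistorSpace V) (hx : x ∈ twistorSpace V) :
    (1 - x * p) * p = x * (1 - x * p) := by
  rw [sub_mul, mul_sub, mul_assoc, hp.1, ← mul_assoc, hx.1]
  noncomm_ring

section Complete

variable [CompleteSpace V]

theorem star_eq_neg_iff_inner : star A = -A ↔ ∀ x y : V, ⟪A x, y⟫_ℝ = -⟪x, A y⟫_ℝ := by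
  rw [ContinuousLinearMap.star_eq_adjoint, eq_comm, ContinuousLinearMap.eq_adjoint_iff]
  refine forall₂_congr fun x y => ?_
  rw [neg_apply, inner_neg_left, neg_eq_iff_eq_neg]

theorem mem_skewAnti_iff : A ∈ skewAnti p ↔ star A = -A ∧ A * p = -(p * A) := by
  rw [star_eq_neg_iff_inner, ← add_eq_zero_iff_eq_neg]
  rfl

theorem mem_twistorSpace_iff : p ∈ twistorSpace V ↔ p * p = -1 ∧ star p = -p := by
  refine ⟨fun h => ⟨h.1, star_eq_neg_iff_inner.2 (inner_apply_of_mem_twistorSpace h)⟩,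
    fun ⟨hsq, hstar⟩ => ⟨hsq, fun v w => ?_⟩⟩
  rw [star_eq_neg_iff_inner.1 hstar, show p (p w) = -w by simpa using congr($hsq w),
    inner_neg_right, neg_neg]

theorem star_one_sub_mul (hp : p ∈ twistorSpace V) (hx : x ∈ twistorSpace V) :
    star (1 - p * x) = 1 - x * p := by
  simp [star_mul, (mem_twistorSpace_iff.1 hp).2, (mem_twistorSpace_iff.1 hx).2]

theorem mul_mem_skewAntiOn (hp : p ∈ twistorSpace V) (hB : B ∈ skewAntiOn M p) :
    p * B ∈ skewAntiOn M p := by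
  obtain ⟨hstar, hanti⟩ := mem_skewAnti_iff.1 hB.1
  refine ⟨mem_skewAnti_iff.2 ⟨?_, ?_⟩, fun v hv => by simp [hB.2 v hv]⟩
  · rw [star_mul, hstar, (mem_twistorSpace_iff.1 hp).2, neg_mul_neg, hanti]
  · rw [mul_assoc, hanti, mul_neg]

theorem conj_mem_skewAntiOn (hp : p ∈ twistorSpace V) (hx : x ∈ twistorSpace V)
    (hC : C * p = x * C) (hN : ∀ v ∈ N, star C v ∈ M) (hB : B ∈ skewAntiOn M p) :
    C * B * star C ∈ skewAntiOn N x := by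
  obtain ⟨hstar, hanti⟩ := mem_skewAnti_iff.1 hB.1
  have hC' : star C * x = p * star C := by
    simpa [star_mul, (mem_twistorSpace_iff.1 hp).2, (mem_twistorSpace_iff.1 hx).2]
      using congr(star $hC).symm
  refine ⟨mem_skewAnti_iff.2 ⟨?_, ?_⟩, fun v hv => by simp [hB.2 _ (hN v hv)]⟩
  · simp [star_mul, hstar, mul_assoc]
  · calc C * B * star C * x = C * (B * p) * star C := by simp only [mul_assoc, hC']
      _ = -((C * p) * B * star C) := by rw [hanti]; noncomm_ring
      _ = _ := by rw [hC]; noncomm_ring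

theorem eq_zero_of_conj_eq_zero (hB : B ∈ skewAntiOn M p) (hCM : Disjoint Mᗮ C.ker)
    (h : C * B * star C = 0) : B = 0 := by
  have hinj : ∀ A : V →L[ℝ] V, C * (B * A) = 0 → B * A = 0 := fun A hA =>
    ContinuousLinearMap.ext fun v => Submodule.disjoint_def.1 hCM _
      (apply_mem_orthogonal_of_mem_skewAntiOn hB _) congr($hA v)
  have hCB : C * B = 0 := by
    have := congr(star $(hinj (star C) (by rwa [← mul_assoc])))
    simpa [star_mul, (mem_skewAnti_iff.1 hB.1).1] using this
  simpa using hinj 1 (by simpa using hCB)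

end Complete

variable [FiniteDimensional ℝ V]

theorem exists_injective_conj (hp : p ∈ twistorSpace V) (hx : x ∈ twistorSpace V)
    (hC : C * p = x * C) (hN : ∀ v ∈ N, star C v ∈ M) (hCM : Disjoint Mᗮ C.ker) :
    ∃ Φ : skewAntiOn M p →ₗ[ℝ] skewAntiOn N x,
      Function.Injective Φ ∧ ∀ B, (Φ B : V →L[ℝ] V) = C * B * star C := by
  let Φ : skewAntiOn M p →ₗ[ℝ] skewAntiOn N x := (LinearMap.mulLeftRight ℝ (C, star C)).restrict
    fun B hB => conj_mem_skewAntiOn hp hx hC hN hB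
  exact ⟨Φ, (injective_iff_map_eq_zero Φ).2 fun B hB =>
    Subtype.ext (eq_zero_of_conj_eq_zero B.2 hCM congr(($hB : V →L[ℝ] V))), fun B => rfl⟩

theorem exists_conj_eq (hp : p ∈ twistorSpace V) (hx : x ∈ twistorSpace V) (hC : C * p = x * C)
    (hN : ∀ v ∈ N, star C v ∈ M) (hCM : Disjoint Mᗮ C.ker)
    (hfin : finrank ℝ (skewAntiOn N x) = finrank ℝ (skewAntiOn M p)) (hB : B ∈ skewAntiOn N x) :
    ∃ B' ∈ skewAntiOn M p, C * B' * star C = B := by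
  obtain ⟨Φ, hinj, hΦ⟩ := exists_injective_conj hp hx hC hN hCM
  obtain ⟨B', hB'⟩ :=
    (LinearMap.injective_iff_surjective_of_finrank_eq_finrank hfin.symm).1 hinj ⟨B, hB⟩
  exact ⟨B', B'.2, by rw [← hΦ, hB']⟩

theorem finrank_skewAntiOn_le (hp : p ∈ twistorSpace V) (hx : x ∈ twistorSpace V)
    (hpM : ∀ v ∈ M, p v ∈ M) (hxM : ∀ v ∈ M, x v ∈ M) (hu : IsUnit (1 - x * p)) :
    finrank ℝ (skewAntiOn M p) ≤ finrank ℝ (skewAntiOn M x) := by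
  have hker : (1 - x * p).ker = ⊥ := LinearMap.isUnit_iff_ker_eq_bot _ |>.1
    (ContinuousLinearMap.isUnit_iff_isUnit_toLinearMap.1 hu)
  obtain ⟨Φ, hinj, -⟩ := exists_injective_conj (N := M) hp hx (one_sub_mul_mul_comm hp hx)
    (fun v hv => by rw [star_one_sub_mul hx hp]; exact M.sub_mem hv (hpM _ (hxM v hv)))
    (hker ▸ disjoint_bot_right)
  exact LinearMap.finrank_le_finrank_of_injective hinj

theorem finrank_eq_of_finrank_skewAntiOn_eq (hp : p ∈ twistorSpace V) (hx : x ∈ twistorSpace V)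
    (hC : C * p = x * C) (hN : ∀ v ∈ N, star C v ∈ M) (hxN : ∀ v ∈ N, x v ∈ N)
    (hCM : Disjoint Mᗮ C.ker)
    (hfin : finrank ℝ (skewAntiOn N x) = finrank ℝ (skewAntiOn M p)) (hne : skewAntiOn N x ≠ ⊥) :
    finrank ℝ N = finrank ℝ M := by
  have hmap : Mᗮ.map (C : V →ₗ[ℝ] V) = Nᗮ := by
    have hle : Mᗮ.map (C : V →ₗ[ℝ] V) ≤ Nᗮ := by
      rintro _ ⟨w, hw, rfl⟩
      refine (Submodule.mem_orthogonal' _ _).2 fun n hn => ?_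
      exact (ContinuousLinearMap.adjoint_inner_right C w n).symm.trans
        (Submodule.inner_left_of_mem_orthogonal (hN n hn) hw)
    suffices h : (Mᗮ.map (C : V →ₗ[ℝ] V))ᗮ ⊓ Nᗮ = ⊥ by
      rw [← Submodule.sup_orthogonal_inf_of_hasOrthogonalProjection hle, h, sup_bot_eq]
    refine (Submodule.eq_bot_iff _).2 fun z ⟨hz, hzN⟩ => ?_
    have hzM : star C z ∈ M := by
      rw [← M.orthogonal_orthogonal, Submodule.mem_orthogonal']
      intro w hw
      exact (ContinuousLinearMap.adjoint_inner_left C w z).trans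
        (Submodule.inner_left_of_mem_orthogonal (Submodule.mem_map_of_mem hw) hz)
    refine eq_zero_of_forall_skewAntiOn_apply_eq_zero hx hxN hne hzN fun B hB => ?_
    obtain ⟨B', hB', rfl⟩ := exists_conj_eq hp hx hC hN hCM hfin hB
    rw [mul_apply_eq_comp, mul_apply_eq_comp, hB'.2 _ hzM, map_zero]
  have hfinmap : finrank ℝ (Mᗮ.map (C : V →ₗ[ℝ] V)) = finrank ℝ Mᗮ := by
    rw [← LinearMap.range_domRestrict]
    exact LinearMap.finrank_range_of_inj (LinearMap.injective_domRestrict_iff.2 hCM)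
  have := M.finrank_add_finrank_orthogonal
  have := N.finrank_add_finrank_orthogonal
  rw [hmap] at hfinmap
  omega

end TwistorAlgebra

section Cayley

variable {V : Type u} [NormedAddCommGroup V] [InnerProductSpace ℝ V]

/-- The Cayley parametrisation of the twistor space around `p`. On `skewAnti p` it is the
conjugation `A ↦ (1 + A) p (1 + A)⁻¹`, see `cayley_eq_conj`; here `p` is moved to the left in order
to have a formula in which `A` occurs only once. -/
def cayley (p A : V →L[ℝ] V) : V →L[ℝ] V := p * ((2 : ℝ) • (1 + A)⁻¹ʳ - 1)

/-- The inverse of `cayley p`. -/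
def cayleyInv (p x : V →L[ℝ] V) : V →L[ℝ] V := (2 : ℝ) • (1 - p * x)⁻¹ʳ - 1

variable {M : Submodule ℝ V} {p x A B N : V →L[ℝ] V}

theorem ringInverse_smul_two_smul (hN : IsUnit N) :
    ((2 : ℝ) • N⁻¹ʳ)⁻¹ʳ = (2⁻¹ : ℝ) • N := by
  have h : IsUnit ((2 : ℝ) • N⁻¹ʳ) := hN.ringInverse.smul (Units.mk0 (2 : ℝ) two_ne_zero)
  rw [← mul_one ((2 : ℝ) • N⁻¹ʳ)⁻¹ʳ, Ring.inverse_mul_eq_iff_eq_mul _ _ _ h, smul_mul_smul_comm,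
    Ring.inverse_mul_cancel N hN, mul_inv_cancel₀ two_ne_zero, one_smul]

theorem cayley_zero (p : V →L[ℝ] V) : cayley p 0 = p := by
  rw [cayley, add_zero, Ring.inverse_one, two_smul, add_sub_cancel_right, mul_one]

theorem one_sub_mul_cayley (hp : p ∈ twistorSpace V) (A : V →L[ℝ] V) :
    1 - p * cayley p A = (2 : ℝ) • (1 + A)⁻¹ʳ := by
  rw [cayley, ← mul_assoc, hp.1, neg_one_mul, neg_sub, sub_sub_cancel]

/-- The derivative of `cayley p` at `A`. -/
def cayleyDeriv (p A : V →L[ℝ] V) : (V →L[ℝ] V) →L[ℝ] (V →L[ℝ] V) :=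
  (-2 : ℝ) • (ContinuousLinearMap.mul ℝ (V →L[ℝ] V) p).comp
    (ContinuousLinearMap.mulLeftRight ℝ (V →L[ℝ] V) (1 + A)⁻¹ʳ (1 + A)⁻¹ʳ)

theorem cayleyDeriv_apply (p A B : V →L[ℝ] V) :
    cayleyDeriv p A B = (-2 : ℝ) • (p * ((1 + A)⁻¹ʳ * B * (1 + A)⁻¹ʳ)) := rfl

theorem cayley_cayleyInv (hp : p ∈ twistorSpace V) (hu : IsUnit (1 - p * x)) :
    cayley p (cayleyInv p x) = x := by
  rw [cayley, cayleyInv, add_sub_cancel, ringInverse_smul_two_smul hu, smul_inv_smul₀ two_ne_zero,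
    sub_sub_cancel_left, mul_neg, ← mul_assoc, hp.1, neg_one_mul, neg_neg]

theorem cayleyDeriv_injective (hp : p ∈ twistorSpace V) (hA : IsUnit (1 + A)) :
    Function.Injective (cayleyDeriv p A) := by
  have hpu : IsUnit p :=
    ⟨⟨p, -p, by rw [mul_neg, hp.1, neg_neg], by rw [neg_mul, hp.1, neg_neg]⟩, rfl⟩
  refine (injective_iff_map_eq_zero _).2 fun B hB => ?_
  rwa [cayleyDeriv_apply, smul_eq_zero_iff_right (by norm_num), hpu.mul_right_eq_zero,
    hA.ringInverse.mul_left_eq_zero, hA.ringInverse.mul_right_eq_zero] at hB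

variable [FiniteDimensional ℝ V]

theorem isUnit_one_add (hA : star A = -A) : IsUnit (1 + A) := by
  rw [ContinuousLinearMap.isUnit_iff_isUnit_toLinearMap, LinearMap.isUnit_iff_ker_eq_bot,
    LinearMap.ker_eq_bot']
  intro v hv
  have hskew := star_eq_neg_iff_inner.1 hA v v
  have hsum : ⟪v, v⟫_ℝ + ⟪A v, v⟫_ℝ = 0 := by
    rw [← inner_add_left, show v + A v = 0 from hv, inner_zero_left]
  rw [real_inner_comm (A v) v] at hskew
  exact (inner_self_eq_zero (𝕜 := ℝ)).1 (by linarith)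

theorem isUnit_one_add_of_mem_skewAnti (hA : A ∈ skewAnti p) : IsUnit (1 + A) :=
  isUnit_one_add (mem_skewAnti_iff.1 hA).1

theorem ringInverse_mul_eq_mul_star (hN : IsUnit N) (h : p * star N = N * p) :
    N⁻¹ʳ * p = p * star N⁻¹ʳ := by
  rw [Ring.inverse_mul_eq_iff_eq_mul _ _ _ hN, ← mul_assoc, ← h, mul_assoc, ← star_mul,
    Ring.inverse_mul_cancel N hN, star_one, mul_one]

theorem ringInverse_one_add_mul (hA : A ∈ skewAnti p) :
    (1 + A)⁻¹ʳ * p = p * star (1 + A)⁻¹ʳ := by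
  obtain ⟨hstar, hanti⟩ := mem_skewAnti_iff.1 hA
  refine ringInverse_mul_eq_mul_star (isUnit_one_add hstar) ?_
  rw [star_add, star_one, hstar, mul_add, add_mul, hanti, mul_one, one_mul, mul_neg]

theorem mul_ringInverse_one_add (hp : p ∈ twistorSpace V) (hA : A ∈ skewAnti p) :
    p * (1 + A)⁻¹ʳ = star (1 + A)⁻¹ʳ * p := by
  calc p * (1 + A)⁻¹ʳ = -(p * ((1 + A)⁻¹ʳ * p) * p) := by
        rw [← mul_assoc, mul_assoc (p * _), hp.1, mul_neg_one, neg_neg]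
    _ = -(p * p * star (1 + A)⁻¹ʳ * p) := by rw [ringInverse_one_add_mul hA, mul_assoc p p]
    _ = star (1 + A)⁻¹ʳ * p := by rw [hp.1, neg_one_mul, neg_mul, neg_neg]

theorem cayley_eq_conj (hA : A ∈ skewAnti p) : cayley p A = (1 + A) * p * (1 + A)⁻¹ʳ := by
  obtain ⟨hstar, hanti⟩ := mem_skewAnti_iff.1 hA
  rw [Ring.eq_mul_inverse_iff_mul_eq _ _ _ (isUnit_one_add hstar), cayley, mul_assoc, sub_mul,
    smul_mul_assoc, Ring.inverse_mul_cancel _ (isUnit_one_add hstar), add_mul, hanti, two_smul]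
  noncomm_ring

theorem cayley_mem_twistorSpace (hp : p ∈ twistorSpace V) (hA : A ∈ skewAnti p) :
    cayley p A ∈ twistorSpace V := by
  have hu := isUnit_one_add_of_mem_skewAnti hA
  refine mem_twistorSpace_iff.2 ⟨?_, ?_⟩
  · calc cayley p A * cayley p A
        = (1 + A) * p * ((1 + A)⁻¹ʳ * (1 + A)) * p * (1 + A)⁻¹ʳ := by
          rw [cayley_eq_conj hA]; noncomm_ring
      _ = (1 + A) * (p * p) * (1 + A)⁻¹ʳ := by
          rw [Ring.inverse_mul_cancel _ hu, mul_one, mul_assoc (1 + A)]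
      _ = -1 := by rw [hp.1, mul_neg_one, neg_mul, Ring.mul_inverse_cancel _ hu]
  · rw [cayley, star_mul, star_sub, star_smul, star_one, star_trivial,
      (mem_twistorSpace_iff.1 hp).2, mul_neg, sub_mul, smul_mul_assoc,
      ← mul_ringInverse_one_add hp hA, one_mul, mul_sub, mul_smul_comm, mul_one]

theorem cayley_apply_of_apply_eq_zero (hA : A ∈ skewAnti p) {v : V} (hv : A v = 0) :
    cayley p A v = p v := by
  have hinv := Ring.inverse_mul_cancel _ (isUnit_one_add_of_mem_skewAnti hA)
  have h : (1 + A)⁻¹ʳ v = v := by simpa [hv] using congr($hinv v)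
  simp [cayley, h, two_smul]

theorem isUnit_one_sub_mul_cayley (hp : p ∈ twistorSpace V) (hA : A ∈ skewAnti p) :
    IsUnit (1 - p * cayley p A) := by
  rw [one_sub_mul_cayley hp]
  exact (isUnit_one_add_of_mem_skewAnti hA).ringInverse.smul (Units.mk0 (2 : ℝ) two_ne_zero)

theorem cayleyInv_cayley (hp : p ∈ twistorSpace V) (hA : A ∈ skewAnti p) :
    cayleyInv p (cayley p A) = A := by
  rw [cayleyInv, one_sub_mul_cayley hp,
    ringInverse_smul_two_smul (isUnit_one_add_of_mem_skewAnti hA), smul_inv_smul₀ two_ne_zero,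
    add_sub_cancel_left]

theorem cayleyInv_self (hp : p ∈ twistorSpace V) : cayleyInv p p = 0 := by
  have h := cayleyInv_cayley hp (A := 0) (Submodule.zero_mem _)
  rwa [cayley_zero] at h

theorem cayleyInv_mem_skewAnti (hp : p ∈ twistorSpace V) (hx : x ∈ twistorSpace V)
    (hu : IsUnit (1 - p * x)) : cayleyInv p x ∈ skewAnti p := by
  have hstar := star_one_sub_mul hp hx
  have hnorm : star (1 - p * x) * (1 - p * x) = (1 - p * x) + star (1 - p * x) := by
    calc star (1 - p * x) * (1 - p * x) = 1 - p * x - x * p + x * (p * p) * x := by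
          rw [hstar]; noncomm_ring
      _ = 1 - p * x - x * p - x * x := by rw [hp.1]; noncomm_ring
      _ = _ := by rw [hstar, hx.1]; noncomm_ring
  have hinv := Ring.mul_inverse_cancel _ hu
  have hsum : star (1 - p * x)⁻¹ʳ + (1 - p * x)⁻¹ʳ = 1 := by
    calc star (1 - p * x)⁻¹ʳ + (1 - p * x)⁻¹ʳ
        = star (1 - p * x)⁻¹ʳ * ((1 - p * x) + star (1 - p * x)) * (1 - p * x)⁻¹ʳ := by
          rw [mul_add, ← star_mul, hinv, star_one, add_mul, mul_assoc, hinv, mul_one, one_mul]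
      _ = star ((1 - p * x) * (1 - p * x)⁻¹ʳ) * ((1 - p * x) * (1 - p * x)⁻¹ʳ) := by
          rw [← hnorm, star_mul]; noncomm_ring
      _ = 1 := by rw [hinv, star_one, one_mul]
  have hcomm : (1 - p * x)⁻¹ʳ * p = p * star (1 - p * x)⁻¹ʳ :=
    ringInverse_mul_eq_mul_star hu (by rw [hstar]; noncomm_ring)
  rw [mem_skewAnti_iff, cayleyInv]
  constructor
  · rw [star_sub, star_smul, star_one, star_trivial, eq_sub_of_add_eq hsum, two_smul, two_smul]
    abel
  · rw [sub_mul, mul_sub, smul_mul_assoc, mul_smul_comm, hcomm, eq_sub_of_add_eq hsum, mul_sub,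
      smul_sub, two_smul ℝ (p * 1)]
    noncomm_ring

theorem cayleyInv_mem_skewAntiOn (hp : p ∈ twistorSpace V) (hx : x ∈ twistorSpace V)
    (hxp : ∀ v ∈ M, x v = p v) (hu : IsUnit (1 - p * x)) : cayleyInv p x ∈ skewAntiOn M p := by
  refine ⟨cayleyInv_mem_skewAnti hp hx hu, fun v hv => ?_⟩
  have h : (1 - p * x) v = (2 : ℝ) • v := by
    simp [hxp v hv, apply_apply_of_mem_twistorSpace hp, two_smul]
  have hinv : (1 - p * x)⁻¹ʳ ((1 - p * x) v) = v := congr($(Ring.inverse_mul_cancel _ hu) v)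
  rw [h, map_smul] at hinv
  simp [cayleyInv, hinv]

theorem hasFDerivAt_cayley (hA : IsUnit (1 + A)) : HasFDerivAt (cayley p) (cayleyDeriv p A) A := by
  obtain ⟨u, hu⟩ := hA
  have hinv := hasFDerivAt_ringInverse (𝕜 := ℝ) u
  rw [hu] at hinv
  have hcomp := (ContinuousLinearMap.mul ℝ (V →L[ℝ] V) p).hasFDerivAt.comp A
    (((hinv.comp A ((hasFDerivAt_id A).const_add 1)).const_smul (2 : ℝ)).sub_const 1)
  refine HasFDerivAt.congr_fderiv (f := cayley p) hcomp ?_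
  ext1 B
  simp [cayleyDeriv, ← hu]

theorem contDiffAt_cayley (hA : IsUnit (1 + A)) : ContDiffAt ℝ ∞ (cayley p) A := by
  obtain ⟨u, hu⟩ := hA
  have hinv : ContDiffAt ℝ ∞ (fun B : V →L[ℝ] V => (1 + B)⁻¹ʳ) A :=
    (hu ▸ contDiffAt_ringInverse ℝ u : ContDiffAt ℝ ∞ Ring.inverse (1 + A)).comp A
      (contDiffAt_const.add contDiffAt_id)
  exact contDiffAt_const.mul ((hinv.const_smul (2 : ℝ)).sub contDiffAt_const)

theorem contDiffAt_cayleyInv (hx : IsUnit (1 - p * x)) : ContDiffAt ℝ ∞ (cayleyInv p) x := by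
  obtain ⟨u, hu⟩ := hx
  have hinv : ContDiffAt ℝ ∞ (fun y : V →L[ℝ] V => (1 - p * y)⁻¹ʳ) x :=
    (hu ▸ contDiffAt_ringInverse ℝ u : ContDiffAt ℝ ∞ Ring.inverse (1 - p * x)).comp x
      (contDiffAt_const.sub (contDiffAt_const.mul contDiffAt_id))
  exact (hinv.const_smul (2 : ℝ)).sub contDiffAt_const

theorem isOpen_isUnit_one_sub_mul (p : V →L[ℝ] V) : IsOpen {y : V →L[ℝ] V | IsUnit (1 - p * y)} :=
  Units.isOpen.preimage (continuous_const.sub (continuous_const.mul continuous_id))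

theorem cayleyDeriv_mul (hp : p ∈ twistorSpace V) (hA : A ∈ skewAnti p) (B : V →L[ℝ] V) :
    cayleyDeriv p A (p * B) = cayley p A * cayleyDeriv p A B := by
  have hu := isUnit_one_add_of_mem_skewAnti hA
  have hinv : p * (1 + A)⁻¹ʳ * p * (1 - A) = -1 := by
    have hanti := (mem_skewAnti_iff.1 hA).2
    calc p * (1 + A)⁻¹ʳ * p * (1 - A) = p * (1 + A)⁻¹ʳ * (p - p * A) := by noncomm_ring
      _ = p * ((1 + A)⁻¹ʳ * (1 + A)) * p := by
        rw [← neg_eq_iff_eq_neg.2 hanti]; noncomm_ring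
      _ = -1 := by rw [Ring.inverse_mul_cancel _ hu, mul_one, hp.1]
  have hkey : cayley p A * p * (1 + A)⁻¹ʳ = p * (1 + A)⁻¹ʳ * p := by
    calc cayley p A * p * (1 + A)⁻¹ʳ
        = ((2 : ℝ) • (p * (1 + A)⁻¹ʳ * p) - p * p) * (1 + A)⁻¹ʳ := by
          rw [cayley, mul_sub, mul_one, sub_mul _ p p, mul_smul_comm, smul_mul_assoc]
      _ = p * (1 + A)⁻¹ʳ * p * ((1 + A) * (1 + A)⁻¹ʳ) := by
          rw [hp.1, ← hinv, ← mul_assoc, two_smul]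
          noncomm_ring
      _ = p * (1 + A)⁻¹ʳ * p := by rw [Ring.mul_inverse_cancel _ hu, mul_one]
  rw [cayleyDeriv_apply, cayleyDeriv_apply, mul_smul_comm]
  simp only [← mul_assoc, hkey]

theorem mem_skewAntiOn_of_hasFDerivAt {H : Type*} [NormedAddCommGroup H] [NormedSpace ℝ H]
    {h : H → V →L[ℝ] V} {h' : H →L[ℝ] V →L[ℝ] V} {u : H} (hh : HasFDerivAt h h' u)
    (hT : ∀ᶠ w in 𝓝 u, h w ∈ twistorSpace V) (hM : ∀ᶠ w in 𝓝 u, ∀ v ∈ M, h w v = h u v) (w : H) :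
    h' w ∈ skewAntiOn M (h u) := by
  have hT' : ∀ᶠ w in 𝓝 u, h w * h w = -1 ∧ star (h w) = -h w :=
    hT.mono fun w hw => mem_twistorSpace_iff.1 hw
  refine ⟨mem_skewAnti_iff.2 ⟨?_, ?_⟩, fun v hv => ?_⟩
  · exact congr($((hh.star.congr_of_eventuallyEq (hT'.mono fun w hw => hw.2.symm)).unique hh.neg) w)
  · have hsq := (hh.mul' hh).congr_of_eventuallyEq (hT'.mono fun w hw => hw.1.symm)
    have := congr($(hsq.unique (hasFDerivAt_const (-1) u)) w)
    simpa [add_eq_zero_iff_eq_neg'] using this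
  · have hconst := (hh.clm_apply (hasFDerivAt_const v u)).congr_of_eventuallyEq
      (hM.mono fun w hw => (hw v hv).symm)
    simpa using congr($(hconst.unique (hasFDerivAt_const (h u v) u)) w)

end Cayley

section CayleyCharts

variable {V : Type u} [NormedAddCommGroup V] [InnerProductSpace ℝ V]
  {X : Set (V →L[ℝ] V)} {p : V →L[ℝ] V} {H : Type*} [NormedAddCommGroup H] [NormedSpace ℝ H]

/-- A parametrisation of a neighbourhood of `p` in `X` by Cayley transforms: `L` is a linear
parametrisation, with left inverse `P`, of a subspace of `skewAnti p`, and `cayley p ∘ L` maps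
the part of norm less than `radius` to a neighbourhood of `p` in `X`. -/
structure CayleyChart (X : Set (V →L[ℝ] V)) (p : V →L[ℝ] V) (H : Type*) [NormedAddCommGroup H]
    [NormedSpace ℝ H] where
  radius : ℝ
  L : H →L[ℝ] (V →L[ℝ] V)
  P : (V →L[ℝ] V) →L[ℝ] H
  mem : p ∈ X
  mem_twistorSpace : p ∈ twistorSpace V
  radius_pos : 0 < radius
  P_L : ∀ v, P (L v) = v
  L_mem_skewAnti : ∀ v, L v ∈ skewAnti p
  cayley_mem : ∀ v, ‖L v‖ < radius → cayley p (L v) ∈ X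
  exists_L_eq_cayleyInv : ∀ x ∈ X, IsUnit (1 - p * x) → ∃ v, L v = cayleyInv p x

namespace CayleyChart

variable (c : CayleyChart X p H)

/-- The parametrisation underlying a Cayley chart. -/
def param (v : H) : V →L[ℝ] V := cayley p (c.L v)

/-- The inverse of `CayleyChart.param`, meaningful where `1 - p * x` is invertible. -/
def coord (x : V →L[ℝ] V) : H := c.P (cayleyInv p x)

theorem param_zero : c.param 0 = p := by rw [param, map_zero, cayley_zero]

theorem L_coord {x : V →L[ℝ] V} (hx : x ∈ X) (hu : IsUnit (1 - p * x)) :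
    c.L (c.coord x) = cayleyInv p x := by
  obtain ⟨v, hv⟩ := c.exists_L_eq_cayleyInv x hx hu
  rw [coord, ← hv, c.P_L]

theorem param_coord {x : V →L[ℝ] V} (hx : x ∈ X) (hu : IsUnit (1 - p * x)) :
    c.param (c.coord x) = x := by
  rw [param, c.L_coord hx hu, cayley_cayleyInv c.mem_twistorSpace hu]

theorem param_mem {v : H} (hv : ‖c.L v‖ < c.radius) : c.param v ∈ X := c.cayley_mem v hv

variable [FiniteDimensional ℝ V]

theorem isUnit_one_add_L (v : H) : IsUnit (1 + c.L v) :=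
  isUnit_one_add_of_mem_skewAnti (c.L_mem_skewAnti v)

theorem isUnit_one_sub_mul_param (v : H) : IsUnit (1 - p * c.param v) :=
  isUnit_one_sub_mul_cayley c.mem_twistorSpace (c.L_mem_skewAnti v)

theorem contDiff_param : ContDiff ℝ ∞ c.param :=
  contDiff_iff_contDiffAt.2 fun v =>
    (contDiffAt_cayley (c.isUnit_one_add_L v)).comp v c.L.contDiff.contDiffAt

theorem hasFDerivAt_param (v : H) : HasFDerivAt c.param ((cayleyDeriv p (c.L v)).comp c.L) v :=
  (hasFDerivAt_cayley (c.isUnit_one_add_L v)).comp v c.L.hasFDerivAt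

theorem contDiffAt_coord {x : V →L[ℝ] V} (hx : IsUnit (1 - p * x)) : ContDiffAt ℝ ∞ c.coord x :=
  c.P.contDiff.contDiffAt.comp x (contDiffAt_cayleyInv hx)

theorem continuousOn_coord : ContinuousOn c.coord {y | IsUnit (1 - p * y)} := fun _ hy =>
  (c.contDiffAt_coord hy).continuousAt.continuousWithinAt

theorem coord_self : c.coord p = 0 := by
  rw [coord, cayleyInv_self c.mem_twistorSpace, map_zero]

theorem coord_param (v : H) : c.coord (c.param v) = v := by
  rw [coord, param, cayleyInv_cayley c.mem_twistorSpace (c.L_mem_skewAnti v), c.P_L]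

theorem injective_fderiv_param (v : H) :
    Function.Injective ((cayleyDeriv p (c.L v)).comp c.L) :=
  (cayleyDeriv_injective c.mem_twistorSpace (c.isUnit_one_add_L v)).comp
    (Function.LeftInverse.injective c.P_L)

theorem exists_isOpen_image_param_eq {U : Set H} (hU : IsOpen U)
    (hball : ∀ v ∈ U, ‖c.L v‖ < c.radius) :
    ∃ O : Set (V →L[ℝ] V), IsOpen O ∧ c.param '' U = X ∩ O := by
  refine ⟨{y | IsUnit (1 - p * y)} ∩ c.coord ⁻¹' U,
    c.continuousOn_coord.isOpen_inter_preimage (isOpen_isUnit_one_sub_mul p) hU, ?_⟩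
  ext y
  constructor
  · rintro ⟨v, hv, rfl⟩
    refine ⟨c.param_mem (hball v hv), c.isUnit_one_sub_mul_param v, ?_⟩
    rwa [mem_preimage, c.coord_param]
  · rintro ⟨hy, hu, hv⟩
    exact ⟨_, hv, c.param_coord hy hu⟩

open Classical in
/-- A Cayley chart as a chart of the topological space `X`. -/
def chart : OpenPartialHomeomorph X H where
  toFun x := c.coord x
  invFun v := if h : c.param v ∈ X then ⟨_, h⟩ else ⟨p, c.mem⟩
  source := {x | IsUnit (1 - p * (x : V →L[ℝ] V)) ∧ ‖c.L (c.coord x)‖ < c.radius}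
  target := {v | ‖c.L v‖ < c.radius}
  map_source' _ hx := hx.2
  map_target' v hv := by
    rw [dif_pos (c.param_mem hv)]
    exact ⟨c.isUnit_one_sub_mul_param v, by rwa [c.coord_param]⟩
  left_inv' x hx := by
    have h := c.param_coord x.2 hx.1
    rw [dif_pos (h.symm ▸ x.2)]
    exact Subtype.ext h
  right_inv' v hv := by
    rw [dif_pos (c.param_mem hv)]
    exact c.coord_param v
  open_source := ((c.continuousOn_coord.isOpen_inter_preimage (isOpen_isUnit_one_sub_mul p)
    (isOpen_lt c.L.continuous.norm continuous_const)).preimage continuous_subtype_val)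
  open_target := isOpen_lt c.L.continuous.norm continuous_const
  continuousOn_toFun :=
    c.continuousOn_coord.comp continuous_subtype_val.continuousOn fun _ hx => hx.1
  continuousOn_invFun := by
    rw [Topology.IsInducing.subtypeVal.continuousOn_iff]
    exact c.contDiff_param.continuous.continuousOn.congr fun v hv =>
      congrArg Subtype.val (dif_pos (c.param_mem hv))

theorem coe_chart_symm {v : H} (hv : v ∈ c.chart.target) :
    (c.chart.symm v : V →L[ℝ] V) = c.param v :=
  congrArg Subtype.val (dif_pos (c.param_mem hv))

theorem self_mem_chart_source : (⟨p, c.mem⟩ : X) ∈ c.chart.source := by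
  have h := c.isUnit_one_sub_mul_param 0
  rw [c.param_zero] at h
  refine ⟨h, ?_⟩
  rw [c.coord_self, map_zero, norm_zero]
  exact c.radius_pos

theorem eventually_coe_chart_symm_eq_param :
    ∀ᶠ v in 𝓝 0, (c.chart.symm v : V →L[ℝ] V) = c.param v := by
  have h := c.chart.map_source c.self_mem_chart_source
  rw [show c.chart ⟨p, c.mem⟩ = 0 from c.coord_self] at h
  filter_upwards [c.chart.open_target.mem_nhds h] with v hv using c.coe_chart_symm hv

end CayleyChart

variable [FiniteDimensional ℝ V]

theorem isComplexSubmanifold_of_cayleyChart (hX : X ⊆ twistorSpace V)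
    (h : ∀ p ∈ X, ∃ (k : ℕ) (c : CayleyChart X p (EuclideanSpace ℂ (Fin k))),
      ∀ v, c.L (Complex.I • v) = p * c.L v) : IsComplexSubmanifold X := by
  refine ⟨hX, fun p hp => ?_⟩
  obtain ⟨k, c, hc⟩ := h p hp
  refine ⟨k, {v | ‖c.L v‖ < c.radius}, c.param, isOpen_lt c.L.continuous.norm continuous_const,
    ⟨0, by simpa using c.radius_pos, c.param_zero⟩, c.contDiff_param.contDiffOn,
    (Function.LeftInverse.injective c.coord_param).injOn,
    fun U' hU' hO => c.exists_isOpen_image_param_eq hO hU', fun z _ => ?_⟩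
  rw [(c.hasFDerivAt_param z).fderiv]
  refine ⟨c.injective_fderiv_param z, fun v => ?_⟩
  rw [ContinuousLinearMap.comp_apply, hc, cayleyDeriv_mul c.mem_twistorSpace (c.L_mem_skewAnti z)]
  rfl

/-- The charted space structure given by a family of Cayley charts. -/
@[reducible]
def cayleyChartedSpace (c : ∀ p : X, CayleyChart X (p : V →L[ℝ] V) H) : ChartedSpace H X where
  atlas := Set.range fun p => (c p).chart
  chartAt p := (c p).chart
  mem_chart_source p := (c p).self_mem_chart_source
  chart_mem_atlas p := ⟨p, rfl⟩

theorem isManifold_cayleyChartedSpace (c : ∀ p : X, CayleyChart X (p : V →L[ℝ] V) H) :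
    @IsManifold ℝ _ H _ _ H _ 𝓘(ℝ, H) ∞ X _ (cayleyChartedSpace c) := by
  let := cayleyChartedSpace c
  refine isManifold_of_contDiffOn _ _ _ ?_
  rintro e e' ⟨p, rfl⟩ ⟨q, rfl⟩
  simp only [modelWithCornersSelf_coe, modelWithCornersSelf_coe_symm, Function.comp_id,
    Function.id_comp, Set.preimage_id, Set.range_id, Set.inter_univ]
  have hcongr : ∀ v ∈ ((c p).chart.symm.trans (c q).chart).source,
      ((c p).chart.symm.trans (c q).chart) v = (c q).coord ((c p).param v) := fun v hv =>
    congrArg (c q).coord ((c p).coe_chart_symm hv.1)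
  refine ContDiffOn.congr (fun v hv => ContDiffAt.contDiffWithinAt ?_) hcongr
  have hu : IsUnit (1 - q * (((c p).chart.symm v : X) : V →L[ℝ] V)) := hv.2.1
  rw [(c p).coe_chart_symm hv.1] at hu
  exact ((c q).contDiffAt_coord hu).comp v (c p).contDiff_param.contDiffAt

section Inclusion

variable (c : ∀ p : X, CayleyChart X (p : V →L[ℝ] V) H)

theorem writtenInExtChartAt_subtype_val_eventuallyEq (p : X) :
    letI := cayleyChartedSpace c
    writtenInExtChartAt 𝓘(ℝ, H) 𝓘(ℝ, V →L[ℝ] V) p (Subtype.val : X → V →L[ℝ] V)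
      =ᶠ[𝓝 (extChartAt 𝓘(ℝ, H) p p)] (c p).param := by
  let := cayleyChartedSpace c
  rw [show extChartAt 𝓘(ℝ, H) p p = 0 from (c p).coord_self]
  exact (c p).eventually_coe_chart_symm_eq_param

theorem hasMFDerivAt_subtype_val (p : X) :
    letI := cayleyChartedSpace c
    HasMFDerivAt 𝓘(ℝ, H) 𝓘(ℝ, V →L[ℝ] V) (Subtype.val : X → V →L[ℝ] V) p
      ((cayleyDeriv (p : V →L[ℝ] V) 0).comp (c p).L) := by
  let := cayleyChartedSpace c
  refine ⟨continuous_subtype_val.continuousAt, HasFDerivAt.hasFDerivWithinAt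
    (HasFDerivAt.congr_of_eventuallyEq ?_ (writtenInExtChartAt_subtype_val_eventuallyEq c p))⟩
  rw [show extChartAt 𝓘(ℝ, H) p p = 0 from (c p).coord_self, ← map_zero (c p).L]
  exact (c p).hasFDerivAt_param 0

theorem contMDiff_subtype_val :
    letI := cayleyChartedSpace c
    ContMDiff 𝓘(ℝ, H) 𝓘(ℝ, V →L[ℝ] V) ∞ (Subtype.val : X → V →L[ℝ] V) := by
  let := cayleyChartedSpace c
  have := isManifold_cayleyChartedSpace c
  intro p
  refine contMDiffAt_iff.2 ⟨continuous_subtype_val.continuousAt, ContDiffAt.contDiffWithinAt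
    ((c p).contDiff_param.contDiffAt.congr_of_eventuallyEq ?_)⟩
  exact writtenInExtChartAt_subtype_val_eventuallyEq c p

end Inclusion

theorem isConnectedIntegralManifold_of_cayleyChart {d : ℕ}
    {D : (V →L[ℝ] V) → Submodule ℝ (V →L[ℝ] V)} (hX : X ⊆ twistorSpace V) (hconn : IsConnected X)
    (c : ∀ p : X, CayleyChart X (p : V →L[ℝ] V) (EuclideanSpace ℝ (Fin d)))
    (hc : ∀ p, Set.range (c p).L = (D p : Set (V →L[ℝ] V)))
    (hD : ∀ p ∈ X, ∀ B ∈ D p, p * B ∈ D p) :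
    IsConnectedIntegralManifold (twistorSpace V) D X := by
  have : ProperSpace (V →L[ℝ] V) := FiniteDimensional.proper ℝ _
  refine ⟨hX, d, X, inferInstance, cayleyChartedSpace c, Subtype.val,
    isManifold_cayleyChartedSpace c, inferInstance, inferInstance,
    isConnected_iff_connectedSpace.1 hconn, contMDiff_subtype_val c, Subtype.val_injective,
    Subtype.range_val, fun p => ?_⟩
  let := cayleyChartedSpace c
  rw [(hasMFDerivAt_subtype_val c p).mfderiv]
  have hinj := (c p).injective_fderiv_param 0
  rw [map_zero] at hinj
  have happ : ∀ B, cayleyDeriv (p : V →L[ℝ] V) 0 B = (-2 : ℝ) • ((p : V →L[ℝ] V) * B) := by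
    simp [cayleyDeriv_apply]
  refine ⟨hinj, Set.ext fun (B : V →L[ℝ] V) => ⟨?_, fun hB => ?_⟩⟩
  · rintro ⟨v, rfl⟩
    change cayleyDeriv (p : V →L[ℝ] V) 0 ((c p).L v) ∈ D p
    rw [happ]
    exact (D p).smul_mem _ (hD p p.2 _ ((hc p).le (mem_range_self v)))
  · obtain ⟨v, hv⟩ := (hc p).ge ((D p).smul_mem (2⁻¹ : ℝ) (hD p p.2 B hB))
    refine ⟨v, ?_⟩
    change cayleyDeriv (p : V →L[ℝ] V) 0 ((c p).L v) = B
    rw [happ, hv, mul_smul_comm, ← mul_assoc, (hX p.2).1, smul_smul]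
    norm_num

end CayleyCharts

section Parametrisation

theorem exists_leftInverse_param {E H : Type*} [NormedAddCommGroup E] [NormedSpace ℝ E]
    [FiniteDimensional ℝ E] [NormedAddCommGroup H] [NormedSpace ℝ H] [FiniteDimensional ℝ H]
    {D : Submodule ℝ E} (e : H ≃ₗ[ℝ] D) :
    ∃ (L : H →L[ℝ] E) (P : E →L[ℝ] H), (∀ v, P (L v) = v) ∧ ∀ v, L v = e v := by
  obtain ⟨P, hP⟩ := LinearMap.exists_leftInverse_of_injective (D.subtype.comp e.toLinearMap)
    (LinearMap.ker_eq_bot.2 (D.injective_subtype.comp e.injective))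
  exact ⟨LinearMap.toContinuousLinearMap (D.subtype.comp e.toLinearMap),
    LinearMap.toContinuousLinearMap P, LinearMap.congr_fun hP, fun _ => rfl⟩

theorem exists_complex_equiv {D : Type*} [AddCommGroup D] [Module ℝ D] [Module.Finite ℝ D]
    (j : Module.End ℝ D) (hj : j * j = -1) :
    ∃ (k : ℕ) (e : EuclideanSpace ℂ (Fin k) ≃ₗ[ℝ] D), ∀ v, e (Complex.I • v) = j (e v) := by
  let φ : ℂ →ₐ[ℝ] Module.End ℝ D := Complex.lift ⟨j, hj⟩
  let _ : Module ℂ D := Module.compHom D φ.toRingHom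
  have hsmul : ∀ (z : ℂ) (x : D), z • x = φ z x := fun _ _ => rfl
  have : IsScalarTower ℝ ℂ D := ⟨fun r z x => by simp [hsmul]⟩
  have : Module.Finite ℂ D := Module.Finite.of_restrictScalars_finite ℝ ℂ D
  refine ⟨Module.finrank ℂ D, (((Module.finBasis ℂ D).equivFun.trans
    (WithLp.linearEquiv 2 ℂ _).symm).symm).restrictScalars ℝ, fun v => ?_⟩
  rw [LinearEquiv.restrictScalars_apply, map_smul, hsmul]
  simp [φ]

end Parametrisation

section SplittingFields

variable {V : Type u} [NormedAddCommGroup V] [InnerProductSpace ℝ V]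
  {F G : (V →L[ℝ] V) → (V →L[ℝ] V)} {K p x B : V →L[ℝ] V}

/-- The field of endomorphisms `F` splits `V` orthogonally and `x`-invariantly, at each point `x`
of the twistor space, as `V = Ker F|_x ⊕ Im F|_x`. -/
structure IsSplittingField (F : (V →L[ℝ] V) → (V →L[ℝ] V)) : Prop where
  orthogonal_ker : ∀ x ∈ twistorSpace V, (F x).kerᗮ = (F x).range
  apply_mem_ker : ∀ x ∈ twistorSpace V, ∀ v ∈ (F x).ker, x v ∈ (F x).ker

/-- Cayley transforms of small elements of `D^F` at `p` stay in `T^F_p`. -/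
def HasCayleyPlaques (F : (V →L[ℝ] V) → (V →L[ℝ] V)) : Prop :=
  ∀ p ∈ twistorSpace V, ∀ᶠ A in 𝓝 0, A ∈ distribution F p → cayley p A ∈ leafSet F p

theorem distribution_congr (h : F x = G x) : distribution F x = distribution G x := by
  ext B
  simp only [distribution, h]

theorem mem_leafSet_congr (hp : F p = G p) (hx : F x = G x) :
    x ∈ leafSet F p ↔ x ∈ leafSet G p := by
  unfold leafSet
  rw [mem_ofPred_eq, mem_ofPred_eq, hp, hx]

theorem distribution_eq_skewAntiOn (hF : IsSplittingField F) (hx : x ∈ twistorSpace V) :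
    distribution F x = skewAntiOn (F x).ker x := by
  refine le_antisymm (fun B hB => ⟨hB.1, hB.2.1⟩) fun B hB => ⟨hB.1, hB.2, fun v _ => ?_⟩
  rw [← hF.orthogonal_ker x hx]
  exact apply_mem_orthogonal_of_mem_skewAntiOn hB v

variable [FiniteDimensional ℝ V]

theorem mul_mem_distribution (hF : IsSplittingField F) (hp : p ∈ twistorSpace V)
    (hB : B ∈ distribution F p) : p * B ∈ distribution F p := by
  rw [distribution_eq_skewAntiOn hF hp] at hB ⊢
  exact mul_mem_skewAntiOn hp hB

theorem ker_eq_ker_iff_range_eq_range (hF : IsSplittingField F) (hp : p ∈ twistorSpace V)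
    (hx : x ∈ twistorSpace V) : (F x).ker = (F p).ker ↔ (F x).range = (F p).range := by
  rw [← hF.orthogonal_ker x hx, ← hF.orthogonal_ker p hp,
    Submodule.orthogonalComplement_eq_orthogonalComplement]

theorem mem_twistorSpace_of_mem_leafSet (hF : IsSplittingField F) (hp : p ∈ twistorSpace V)
    (hx : x ∈ leafSet F p) : x ∈ twistorSpace V := by
  obtain ⟨hxker, ⟨L, hL, hxL⟩, -⟩ := hx
  have hpker : ∀ m ∈ (F p).ker, p m ∈ (F p).ker := hF.apply_mem_ker p hp
  have hsplit : ∀ v : V, ∃ m ∈ (F p).ker, ∃ w : (F p).range, m + w = v := fun v => by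
    obtain ⟨m, hm, w, hw, rfl⟩ := Submodule.exists_add_mem_mem_orthogonal (K := (F p).ker) v
    exact ⟨m, hm, ⟨w, (hF.orthogonal_ker p hp).le hw⟩, rfl⟩
  have horth : ∀ m ∈ (F p).ker, ∀ w : (F p).range, ⟪m, (w : V)⟫_ℝ = 0 := fun m hm w =>
    Submodule.inner_right_of_mem_orthogonal hm ((hF.orthogonal_ker p hp).ge w.2)
  refine ⟨ContinuousLinearMap.ext fun v => ?_, fun v v' => ?_⟩
  · obtain ⟨m, hm, w, rfl⟩ := hsplit v
    have hm2 : x (x m) = -m := by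
      rw [hxker m hm, hxker _ (hpker m hm), apply_apply_of_mem_twistorSpace hp]
    have hw2 : x (x w) = -(w : V) := by
      rw [hxL, hxL, apply_apply_of_mem_twistorSpace hL, Submodule.coe_neg]
    simp [hm2, hw2, add_comm]
  · obtain ⟨m, hm, w, rfl⟩ := hsplit v
    obtain ⟨m', hm', w', rfl⟩ := hsplit v'
    have hw : ⟪((L w : (F p).range) : V), (L w' : (F p).range)⟫_ℝ = ⟪(w : V), w'⟫_ℝ := hL.2 w w'
    simp only [map_add, hxker m hm, hxker m' hm', hxL, inner_add_left, inner_add_right, hw, hp.2,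
      horth _ (hpker m hm), horth m hm, real_inner_comm (p m'), real_inner_comm m',
      horth _ (hpker m' hm'), horth _ hm']

theorem mem_leafSet_iff (hF : IsSplittingField F) (hp : p ∈ twistorSpace V) :
    x ∈ leafSet F p ↔
      x ∈ twistorSpace V ∧ (∀ v ∈ (F p).ker, x v = p v) ∧ (F x).ker = (F p).ker := by
  constructor
  · intro h
    have hx := mem_twistorSpace_of_mem_leafSet hF hp h
    exact ⟨hx, h.1, (ker_eq_ker_iff_range_eq_range hF hp hx).2 h.2.2⟩
  · rintro ⟨hx, hxp, hker⟩
    have hxrange : ∀ v ∈ (F p).range, x v ∈ (F p).range := by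
      rw [← hF.orthogonal_ker p hp, ← hker]
      exact fun v => apply_mem_orthogonal_of_mem_twistorSpace hx (hF.apply_mem_ker x hx)
    refine ⟨hxp, ⟨(x.comp (F p).range.subtypeL).codRestrict (F p).range fun v => hxrange v v.2,
      ⟨?_, fun v w => hx.2 v w⟩, fun v => rfl⟩, (ker_eq_ker_iff_range_eq_range hF hp hx).1 hker⟩
    ext v
    exact apply_apply_of_mem_twistorSpace hx (v : V)

theorem self_mem_leafSet (hF : IsSplittingField F) (hp : p ∈ twistorSpace V) : p ∈ leafSet F p :=
  (mem_leafSet_iff hF hp).2 ⟨hp, fun _ _ => rfl, rfl⟩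

theorem leafSet_eq_of_mem (hF : IsSplittingField F) (hp : p ∈ twistorSpace V)
    (hx : x ∈ leafSet F p) : leafSet F x = leafSet F p := by
  obtain ⟨hxT, hxp, hker⟩ := (mem_leafSet_iff hF hp).1 hx
  ext y
  rw [mem_leafSet_iff hF hp, mem_leafSet_iff hF hxT, hker]
  refine and_congr_right fun _ => and_congr_left fun _ => forall₂_congr fun v hv => ?_
  rw [hxp v hv]

theorem finrank_distribution_eq_of_mem_leafSet (hF : IsSplittingField F) (hp : p ∈ twistorSpace V)
    (hx : x ∈ leafSet F p) (hu : IsUnit (1 - p * x)) :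
    finrank ℝ (distribution F x) = finrank ℝ (distribution F p) := by
  obtain ⟨hxT, -, hker⟩ := (mem_leafSet_iff hF hp).1 hx
  have hpM := hF.apply_mem_ker p hp
  have hxM := hker ▸ hF.apply_mem_ker x hxT
  have hu' : IsUnit (1 - x * p) := star_one_sub_mul hp hxT ▸ hu.star
  rw [distribution_eq_skewAntiOn hF hxT, distribution_eq_skewAntiOn hF hp, hker]
  exact le_antisymm (finrank_skewAntiOn_le hxT hp hxM hpM hu)
    (finrank_skewAntiOn_le hp hxT hpM hxM hu')

end SplittingFields

section Component

variable {V : Type u} [NormedAddCommGroup V] [InnerProductSpace ℝ V] [FiniteDimensional ℝ V]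
  {F : (V →L[ℝ] V) → (V →L[ℝ] V)} {K p : V →L[ℝ] V}

theorem component_subset_twistorSpace (hF : IsSplittingField F) (hK : K ∈ twistorSpace V) :
    connectedComponentIn (leafSet F K) K ⊆ twistorSpace V := fun _ hx =>
  mem_twistorSpace_of_mem_leafSet hF hK (connectedComponentIn_subset _ _ hx)

theorem leafSet_eq_of_mem_component (hF : IsSplittingField F) (hK : K ∈ twistorSpace V)
    (hp : p ∈ connectedComponentIn (leafSet F K) K) : leafSet F p = leafSet F K :=
  leafSet_eq_of_mem hF hK (connectedComponentIn_subset _ _ hp)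

theorem subset_component_of_isPreconnected (hF : IsSplittingField F) (hK : K ∈ twistorSpace V)
    (hp : p ∈ connectedComponentIn (leafSet F K) K) {S : Set (V →L[ℝ] V)} (hS : IsPreconnected S)
    (hpS : p ∈ S) (hSF : S ⊆ leafSet F p) : S ⊆ connectedComponentIn (leafSet F K) K := by
  rw [connectedComponentIn_eq hp]
  exact hS.subset_connectedComponentIn hpS (leafSet_eq_of_mem_component hF hK hp ▸ hSF)

theorem finrank_distribution_eq_of_mem_component (hF : IsSplittingField F)
    (hK : K ∈ twistorSpace V) (hp : p ∈ connectedComponentIn (leafSet F K) K) :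
    finrank ℝ (distribution F p) = finrank ℝ (distribution F K) := by
  refine isPreconnected_connectedComponentIn.constant_of_mapsTo
    IsDiscrete.univ (f := fun x => finrank ℝ (distribution F x)) ?_ (mapsTo_univ _ _) hp
    (mem_connectedComponentIn (self_mem_leafSet hF hK))
  intro x hx
  have hxT := component_subset_twistorSpace hF hK hx
  have hu : IsUnit (1 - x * x) := by
    simpa [cayley_zero] using isUnit_one_sub_mul_cayley hxT (A := 0) (Submodule.zero_mem _)
  refine (continuousWithinAt_const (b := finrank ℝ (distribution F x))).congr_of_eventuallyEq
    ?_ rfl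
  filter_upwards [self_mem_nhdsWithin,
    mem_nhdsWithin_of_mem_nhds ((isOpen_isUnit_one_sub_mul x).mem_nhds hu)] with y hy hyu
  refine finrank_distribution_eq_of_mem_leafSet hF hxT ?_ hyu
  rw [leafSet_eq_of_mem_component hF hK hx]
  exact connectedComponentIn_subset _ _ hy

theorem exists_cayleyChart_component (hF : IsSplittingField F) (hFc : HasCayleyPlaques F)
    (hK : K ∈ twistorSpace V) (hp : p ∈ connectedComponentIn (leafSet F K) K)
    {H : Type*} [NormedAddCommGroup H] [NormedSpace ℝ H] [FiniteDimensional ℝ H]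
    (e : H ≃ₗ[ℝ] distribution F p) :
    ∃ c : CayleyChart (connectedComponentIn (leafSet F K) K) p H, ∀ v, c.L v = e v := by
  have hpT := component_subset_twistorSpace hF hK hp
  obtain ⟨ε, hε, hball⟩ := Metric.eventually_nhds_iff_ball.1 (hFc p hpT)
  obtain ⟨L, P, hPL, hLe⟩ := exists_leftInverse_param e
  have hL : ∀ v, L v ∈ distribution F p := fun v => hLe v ▸ (e v).2
  refine ⟨⟨ε, L, P, hp, hpT, hε, hPL, fun v => (hL v).1, ?_, fun x hx hu => ?_⟩, hLe⟩
  · have hconv : Convex ℝ (L ⁻¹' Metric.ball 0 ε) :=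
      (convex_ball (0 : V →L[ℝ] V) ε).linear_preimage L.toLinearMap
    have hcont : Continuous fun v => cayley p (L v) := continuous_iff_continuousAt.2 fun v =>
      (contDiffAt_cayley (isUnit_one_add_of_mem_skewAnti (hL v).1)).continuousAt.comp
        L.continuous.continuousAt
    have hsub := subset_component_of_isPreconnected hF hK hp
      (hconv.isPreconnected.image _ hcont.continuousOn)
      ⟨0, by simpa using hε, by simp [cayley_zero]⟩
      (image_subset_iff.2 fun v hv => hball _ hv (hL v))
    exact fun v hv => hsub ⟨v, by simpa using hv, rfl⟩
  · have hxp : x ∈ leafSet F p :=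
      leafSet_eq_of_mem_component hF hK hp ▸ connectedComponentIn_subset _ _ hx
    obtain ⟨hxT, hxp, -⟩ := (mem_leafSet_iff hF hpT).1 hxp
    have hmem := cayleyInv_mem_skewAntiOn hpT hxT hxp hu
    rw [← distribution_eq_skewAntiOn hF hpT] at hmem
    exact ⟨e.symm ⟨_, hmem⟩, by rw [hLe, e.apply_symm_apply]⟩

theorem isConnectedIntegralManifold_component (hF : IsSplittingField F) (hFc : HasCayleyPlaques F)
    (hK : K ∈ twistorSpace V) :
    IsConnectedIntegralManifold (twistorSpace V) (distribution F)
      (connectedComponentIn (leafSet F K) K) := by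
  have hsub := component_subset_twistorSpace hF hK
  have hfin : ∀ p : connectedComponentIn (leafSet F K) K,
      finrank ℝ (EuclideanSpace ℝ (Fin (finrank ℝ (distribution F K)))) =
        finrank ℝ (distribution F p) := fun p => by
    rw [finrank_euclideanSpace_fin, finrank_distribution_eq_of_mem_component hF hK p.2]
  choose c hc using fun p => exists_cayleyChart_component hF hFc hK (Subtype.property p)
    (LinearEquiv.ofFinrankEq _ _ (hfin p))
  refine isConnectedIntegralManifold_of_cayleyChart hsub
    (isConnected_connectedComponentIn_iff.2 (self_mem_leafSet hF hK)) c (fun p => ?_)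
    fun p hp B hB => mul_mem_distribution hF (hsub hp) hB
  rw [funext (hc p), ← Function.comp_def Subtype.val, EquivLike.range_comp, Subtype.range_val]

theorem isComplexSubmanifold_component (hF : IsSplittingField F) (hFc : HasCayleyPlaques F)
    (hK : K ∈ twistorSpace V) : IsComplexSubmanifold (connectedComponentIn (leafSet F K) K) := by
  refine isComplexSubmanifold_of_cayleyChart (component_subset_twistorSpace hF hK) fun p hp => ?_
  have hpT := component_subset_twistorSpace hF hK hp
  let j : Module.End ℝ (distribution F p) := (LinearMap.mulLeft ℝ p).restrict
    fun B hB => mul_mem_distribution hF hpT hB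
  have hj : j * j = -1 := LinearMap.ext fun B => Subtype.ext <| by
    change p * (p * (B : V →L[ℝ] V)) = -B
    rw [← mul_assoc, hpT.1, neg_one_mul]
  obtain ⟨k, e, he⟩ := exists_complex_equiv j hj
  obtain ⟨c, hc⟩ := exists_cayleyChart_component hF hFc hK hp e
  refine ⟨k, c, fun v => ?_⟩
  rw [hc, hc, he]
  rfl

end Component

section KernelStable

variable {V : Type u} [NormedAddCommGroup V] [InnerProductSpace ℝ V]
  {G : (V →L[ℝ] V) → (V →L[ℝ] V)} {p x B : V →L[ℝ] V}

/-- Endomorphisms that agree with `x ∈ T(V)` on `Ker G|_x` do not shrink this kernel. The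
endomorphism `y` ranges over all of `End V`, so that the condition can be differentiated along the
lines `t ↦ x + t B`. -/
def IsKernelStable (G : (V →L[ℝ] V) → (V →L[ℝ] V)) : Prop :=
  ∀ x ∈ twistorSpace V, ∀ y : V →L[ℝ] V, (∀ v ∈ (G x).ker, y v = x v) → (G x).ker ≤ (G y).ker

theorem IsKernelStable.fderiv_apply_eq_zero (hG : IsKernelStable G) (hx : x ∈ twistorSpace V)
    (hGx : DifferentiableAt ℝ G x) (hB : ∀ v ∈ (G x).ker, B v = 0) {v : V} (hv : v ∈ (G x).ker) :
    fderiv ℝ G x B v = 0 := by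
  have hline : HasDerivAt (fun t : ℝ => G (x + t • B) v) (fderiv ℝ G x B v) 0 := by
    simpa using HasDerivAt.clm_apply (hGx.hasFDerivAt.hasLineDerivAt B)
      (hasDerivAt_const (0 : ℝ) v)
  have hzero : (fun t : ℝ => G (x + t • B) v) = fun _ => 0 := funext fun t =>
    hG x hx (x + t • B) (fun w hw => by simp [hB w hw]) hv
  exact hline.unique (hzero ▸ hasDerivAt_const (0 : ℝ) (0 : V))

variable [FiniteDimensional ℝ V]

theorem hasCayleyPlaques_of_isKernelStable (hG : IsSplittingField G) (hGs : IsKernelStable G)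
    (hGc : Continuous G) : HasCayleyPlaques G := by
  intro p hp
  have hcont : Tendsto (fun A => G (cayley p A)) (𝓝 0) (𝓝 (G p)) := by
    have h := hGc.continuousAt.comp (contDiffAt_cayley (p := p) (A := 0) (by simp)).continuousAt
    simpa [ContinuousAt, Function.comp_def, cayley_zero] using h
  filter_upwards [hcont.eventually (eventually_ker_eq_of_ker_le (G p))] with A hker hA
  have hAp : ∀ v ∈ (G p).ker, cayley p A v = p v := fun v hv =>
    cayley_apply_of_apply_eq_zero hA.1 (hA.2.1 v hv)
  exact (mem_leafSet_iff hG hp).2 ⟨cayley_mem_twistorSpace hp hA.1, hAp, hker (hGs p hp _ hAp)⟩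

end KernelStable

section ConstantRank

variable {V : Type u} [NormedAddCommGroup V] [InnerProductSpace ℝ V] [FiniteDimensional ℝ V]
  {G : (V →L[ℝ] V) → (V →L[ℝ] V)} {p x : V →L[ℝ] V} {N : Submodule ℝ V}

theorem starProjection_orthogonal_mul_comm (hx : x ∈ twistorSpace V) (hN : ∀ v ∈ N, x v ∈ N) :
    Nᗮ.starProjection * x = x * Nᗮ.starProjection := by
  ext v
  obtain ⟨m, hm, w, hw, rfl⟩ := Submodule.exists_add_mem_mem_orthogonal (K := N) v
  have hxw := apply_mem_orthogonal_of_mem_twistorSpace hx hN hw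
  have h0 : ∀ m ∈ N, Nᗮ.starProjection m = 0 := fun m hm =>
    Submodule.starProjection_orthogonal_apply_eq_zero hm
  simp only [mul_apply_eq_comp, map_add, h0 m hm, h0 _ (hN m hm), map_zero,
    Submodule.starProjection_eq_self_iff.2 hw, Submodule.starProjection_eq_self_iff.2 hxw]

theorem ker_starProjection_orthogonal_mul (R C : V →L[ℝ] V) :
    (R.kerᗮ.starProjection * C).ker = (R * C).ker := by
  ext v
  have h : R.kerᗮ.starProjection (C v) = 0 ↔ C v ∈ R.kerᗮᗮ :=
    Submodule.starProjection_apply_eq_zero_iff _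
  rw [Submodule.orthogonal_orthogonal] at h
  exact h

theorem finrank_ker_eq_of_finrank_distribution_eq (hG : IsSplittingField G)
    (hp : p ∈ twistorSpace V) (hx : x ∈ twistorSpace V)
    (hdisj : Disjoint (G p).kerᗮ (G x * (1 - x * p)).ker)
    (hfin : finrank ℝ (distribution G x) = finrank ℝ (distribution G p))
    (hne : distribution G x ≠ ⊥) : finrank ℝ (G x).ker = finrank ℝ (G p).ker := by
  rw [distribution_eq_skewAntiOn hG hx] at hfin hne
  rw [distribution_eq_skewAntiOn hG hp] at hfin
  have hxN := hG.apply_mem_ker x hx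
  refine finrank_eq_of_finrank_skewAntiOn_eq (C := (G x).kerᗮ.starProjection * (1 - x * p)) hp hx
    ?_ (fun v hv => ?_) hxN ?_ hfin hne
  · rw [mul_assoc, one_sub_mul_mul_comm hp hx, ← mul_assoc,
      starProjection_orthogonal_mul_comm hx hxN, mul_assoc]
  · have hv0 : (G x).kerᗮ.starProjection v = 0 :=
      Submodule.starProjection_orthogonal_apply_eq_zero hv
    rw [star_mul, (isSelfAdjoint_starProjection _).star_eq]
    simp [hv0]
  · rwa [ker_starProjection_orthogonal_mul]

theorem eventually_finrank_ker_eq (hG : IsSplittingField G) (hp : p ∈ twistorSpace V)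
    (hGp : ContinuousAt G p) : ∀ᶠ x in 𝓝 p, x ∈ twistorSpace V →
      finrank ℝ (distribution G x) = finrank ℝ (distribution G p) → distribution G x ≠ ⊥ →
      finrank ℝ (G x).ker = finrank ℝ (G p).ker := by
  have hdisj : Disjoint (G p).kerᗮ (G p * (1 - p * p)).ker := by
    have h2 : G p * (1 - p * p) = (2 : ℝ) • G p := by
      rw [hp.1, sub_neg_eq_add, one_add_one_eq_two, mul_two, two_smul]
    rw [h2, ContinuousLinearMap.toLinearMap_smul, LinearMap.ker_smul _ _ two_ne_zero]
    exact (Submodule.orthogonal_disjoint _).symm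
  obtain ⟨c, hc, hev⟩ := exists_eventually_le_norm_apply hdisj
  have hcont : ContinuousAt (fun x => G x * (1 - x * p)) p :=
    hGp.mul (continuousAt_const.sub (continuousAt_id.mul continuousAt_const))
  filter_upwards [hcont.eventually hev] with x hx hxT
  exact finrank_ker_eq_of_finrank_distribution_eq hG hp hxT (disjoint_ker_of_le_norm_apply hc hx)

end ConstantRank

section IntegralMaps

variable {V : Type u} [NormedAddCommGroup V] [InnerProductSpace ℝ V]
  {H : Type*} [NormedAddCommGroup H] [NormedSpace ℝ H] {G : (V →L[ℝ] V) → (V →L[ℝ] V)}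
  {h : H → V →L[ℝ] V} {u₀ : H}

theorem eventually_apply_eq_of_fderiv_apply_eq_zero {M : Submodule ℝ V}
    (hh : ∀ᶠ u in 𝓝 u₀, DifferentiableAt ℝ h u)
    (h0 : ∀ᶠ u in 𝓝 u₀, ∀ w, ∀ v ∈ M, fderiv ℝ h u w v = 0) :
    ∀ᶠ u in 𝓝 u₀, ∀ v ∈ M, h u v = h u₀ v := by
  obtain ⟨r, hr, hball⟩ := Metric.eventually_nhds_iff_ball.1 (hh.and h0)
  filter_upwards [Metric.ball_mem_nhds u₀ hr] with u hu v hv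
  have hder : ∀ u ∈ Metric.ball u₀ r, HasFDerivAt (fun u => h u v) (0 : H →L[ℝ] V) u := by
    intro u hu
    convert (hball u hu).1.hasFDerivAt.clm_apply (hasFDerivAt_const v u) using 1
    ext w
    simp [(hball u hu).2 w v hv]
  exact Metric.isOpen_ball.is_const_of_fderiv_eq_zero (convex_ball u₀ r).isPreconnected
    (fun u hu => (hder u hu).differentiableAt.differentiableWithinAt)
    (fun u hu => (hder u hu).fderiv) hu (Metric.mem_ball_self hr)

variable [FiniteDimensional ℝ V]

theorem eventually_ker_comp_eq (hG : IsSplittingField G) (hGs : IsKernelStable G)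
    (hGd : ContDiff ℝ 1 G) (hh : ContDiffAt ℝ 1 h u₀)
    (hT : ∀ᶠ u in 𝓝 u₀, h u ∈ twistorSpace V)
    (hD : ∀ᶠ u in 𝓝 u₀, ∀ w, fderiv ℝ h u w ∈ distribution G (h u))
    (hfin : ∀ᶠ u in 𝓝 u₀, finrank ℝ (distribution G (h u)) = finrank ℝ (distribution G (h u₀)))
    (hne : finrank ℝ (distribution G (h u₀)) ≠ 0) :
    ∀ᶠ u in 𝓝 u₀, (G (h u)).ker = (G (h u₀)).ker := by
  have hp := hT.self_of_nhds
  refine eventually_ker_eq (hGd.contDiffAt.comp u₀ hh) ?_ ?_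
  · filter_upwards [hT, hD, hh.eventually (by simp)] with u hu hDu hhu w v hv
    have hGu := (hGd.differentiable one_ne_zero) (h u)
    rw [fderiv_fun_comp u hGu (hhu.differentiableAt one_ne_zero)]
    exact hGs.fderiv_apply_eq_zero hu hGu (hDu w).2.1 hv
  · filter_upwards [hT, hfin,
      hh.continuousAt.eventually (eventually_finrank_ker_eq hG hp hGd.continuous.continuousAt)]
      with u hu hfu hker
    exact hker hu hfu fun h0 => hne (by rw [← hfu, h0, finrank_bot])

theorem eventually_mem_leafSet (hG : IsSplittingField G) (hGs : IsKernelStable G)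
    (hGd : ContDiff ℝ 1 G) (hh : ContDiffAt ℝ 1 h u₀)
    (hT : ∀ᶠ u in 𝓝 u₀, h u ∈ twistorSpace V)
    (hD : ∀ᶠ u in 𝓝 u₀, ∀ w, fderiv ℝ h u w ∈ distribution G (h u))
    (hfin : ∀ᶠ u in 𝓝 u₀, finrank ℝ (distribution G (h u)) = finrank ℝ (distribution G (h u₀))) :
    ∀ᶠ u in 𝓝 u₀, h u ∈ leafSet G (h u₀) := by
  have hp := hT.self_of_nhds
  have hdiff : ∀ᶠ u in 𝓝 u₀, DifferentiableAt ℝ h u :=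
    (hh.eventually (by simp)).mono fun u hu => hu.differentiableAt one_ne_zero
  by_cases hd : finrank ℝ (distribution G (h u₀)) = 0
  · have hconst := eventually_apply_eq_of_fderiv_apply_eq_zero (M := ⊤) hdiff <| by
      filter_upwards [hD, hfin] with u hu hfu w v _
      have hbot : distribution G (h u) = ⊥ := Submodule.finrank_eq_zero.1 (hfu.trans hd)
      rw [show fderiv ℝ h u w = 0 from (Submodule.mem_bot ℝ).1 (hbot ▸ hu w), zero_apply]
    filter_upwards [hconst] with u hu
    rw [show h u = h u₀ from ContinuousLinearMap.ext fun v => hu v trivial]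
    exact self_mem_leafSet hG hp
  · have hker := eventually_ker_comp_eq hG hGs hGd hh hT hD hfin hd
    have hconst := eventually_apply_eq_of_fderiv_apply_eq_zero (M := (G (h u₀)).ker) hdiff <| by
      filter_upwards [hD, hker] with u hu hku w v hv
      exact (hu w).2.1 v (hku.ge hv)
    filter_upwards [hT, hker, hconst] with u hu hku hcu
    exact (mem_leafSet_iff hG hp).2 ⟨hu, hcu, hku⟩

end IntegralMaps

section Maximality

variable {V : Type u} [NormedAddCommGroup V] [InnerProductSpace ℝ V]
  {F : (V →L[ℝ] V) → (V →L[ℝ] V)} {K : V →L[ℝ] V}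

/-- Every `C¹` map into `T(V)` that is tangent to `D^F`, and along which `D^F` has constant rank,
locally stays in the set `T^F` of each of its points. -/
def TrapsIntegralMaps (F : (V →L[ℝ] V) → (V →L[ℝ] V)) : Prop :=
  ∀ ⦃d : ℕ⦄ ⦃h : EuclideanSpace ℝ (Fin d) → (V →L[ℝ] V)⦄ ⦃u₀ : EuclideanSpace ℝ (Fin d)⦄,
    ContDiffAt ℝ 1 h u₀ → (∀ᶠ u in 𝓝 u₀, h u ∈ twistorSpace V) →
    (∀ᶠ u in 𝓝 u₀, ∀ w, fderiv ℝ h u w ∈ distribution F (h u)) →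
    (∀ᶠ u in 𝓝 u₀, finrank ℝ (distribution F (h u)) = finrank ℝ (distribution F (h u₀))) →
    ∀ᶠ u in 𝓝 u₀, h u ∈ leafSet F (h u₀)

theorem eventually_mem_leafSet_of_range_mfderiv (hF : TrapsIntegralMaps F) {d : ℕ} {N : Type*}
    [TopologicalSpace N] [ChartedSpace (EuclideanSpace ℝ (Fin d)) N] [IsManifold (𝓡 d) ∞ N]
    {ι : N → V →L[ℝ] V} (hι : ContMDiff (𝓡 d) 𝓘(ℝ, V →L[ℝ] V) ∞ ι)
    (hιT : ∀ x, ι x ∈ twistorSpace V)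
    (hιD : ∀ x : N, Function.Injective (mfderiv (𝓡 d) 𝓘(ℝ, V →L[ℝ] V) ι x) ∧
      range (mfderiv (𝓡 d) 𝓘(ℝ, V →L[ℝ] V) ι x) = (distribution F (ι x) : Set (V →L[ℝ] V)))
    (x : N) : ∀ᶠ y in 𝓝 x, ι y ∈ leafSet F (ι x) := by
  have hfin : ∀ y, finrank ℝ (distribution F (ι y)) = d := fun y => by
    let A : EuclideanSpace ℝ (Fin d) →ₗ[ℝ] (V →L[ℝ] V) :=
      (mfderiv (𝓡 d) 𝓘(ℝ, V →L[ℝ] V) ι y).toLinearMap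
    have hA : A.range = distribution F (ι y) := SetLike.coe_injective (hιD y).2
    rw [← hA, LinearMap.finrank_range_of_inj (f := A) (hιD y).1, finrank_euclideanSpace_fin]
  have hsymm := contMDiffOn_extChartAt_symm (I := 𝓡 d) (n := ∞) x
  have htarget := (isOpen_extChartAt_target (I := 𝓡 d) x).eventually_mem
    (mem_extChartAt_target x)
  have hsymmAt : ∀ u ∈ (extChartAt (𝓡 d) x).target,
      ContMDiffAt 𝓘(ℝ, EuclideanSpace ℝ (Fin d)) (𝓡 d) ∞ (extChartAt (𝓡 d) x).symm u :=
    fun u hu => hsymm.contMDiffAt ((isOpen_extChartAt_target (I := 𝓡 d) x).mem_nhds hu)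
  have hev := hF (h := ι ∘ (extChartAt (𝓡 d) x).symm) (u₀ := extChartAt (𝓡 d) x x)
    (((hι _).comp _ (hsymmAt _ (mem_extChartAt_target x))).contDiffAt.of_le (by simp))
    (.of_forall fun u => hιT _) ?_ (.of_forall fun u => by simp only [Function.comp, hfin])
  · filter_upwards [(continuousAt_extChartAt (I := 𝓡 d) x).eventually hev,
      extChartAt_source_mem_nhds (I := 𝓡 d) x] with y hy hys
    simpa only [Function.comp_apply, (extChartAt (𝓡 d) x).left_inv hys, extChartAt_to_inv]
      using hy
  · filter_upwards [htarget] with u hu w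
    have hchain := mfderiv_comp u ((hι _).mdifferentiableAt (by simp))
      ((hsymmAt u hu).mdifferentiableAt (by simp))
    rw [mfderiv_eq_fderiv] at hchain
    rw [← SetLike.mem_coe, Function.comp_apply, ← (hιD _).2, hchain]
    exact ⟨_, rfl⟩

theorem isConnectedIntegralManifold_subset_component [FiniteDimensional ℝ V]
    (hF : IsSplittingField F) (hFt : TrapsIntegralMaps F) (hK : K ∈ twistorSpace V)
    {Y : Set (V →L[ℝ] V)} (hY : IsConnectedIntegralManifold (twistorSpace V) (distribution F) Y)
    (hne : (connectedComponentIn (leafSet F K) K ∩ Y).Nonempty) :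
    Y ⊆ connectedComponentIn (leafSet F K) K := by
  obtain ⟨hYT, d, N, _, _, ι, _, _, _, _, hι, -, rfl, hιD⟩ := hY
  have hιT : ∀ x, ι x ∈ twistorSpace V := fun x => hYT ⟨x, rfl⟩
  have hloc := eventually_mem_leafSet_of_range_mfderiv hFt hι hιT hιD
  obtain ⟨_, hq, x₀, rfl⟩ := hne
  have hclopen : IsClopen {x | ι x ∈ leafSet F (ι x₀)} := by
    refine ⟨isOpen_compl_iff.1 (isOpen_iff_mem_nhds.2 fun x hx => ?_),
      isOpen_iff_mem_nhds.2 fun x hx => ?_⟩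
    · filter_upwards [hloc x] with y hy hyK
      refine hx ?_
      rw [← leafSet_eq_of_mem hF (hιT x₀) hyK, leafSet_eq_of_mem hF (hιT x) hy]
      exact self_mem_leafSet hF (hιT x)
    · filter_upwards [hloc x] with y hy
      exact leafSet_eq_of_mem hF (hιT x₀) hx ▸ hy
  have huniv := hclopen.eq_univ ⟨x₀, self_mem_leafSet hF (hιT x₀)⟩
  exact subset_component_of_isPreconnected hF hK hq (isPreconnected_range hι.continuous)
    (mem_range_self x₀) (range_subset_iff.2 fun x => huniv.ge (mem_univ x))

end Maximality

section Relations

theorem commute_anticommutator_right {R : Type*} [Ring R] {J x : R} (hx : x * x = -1) :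
    Commute (J * x + x * J) x := by
  have h : ∀ y : R, y * x * x = -y := fun y => by rw [mul_assoc, hx, mul_neg_one]
  simp only [Commute, SemiconjBy, add_mul, mul_add, ← mul_assoc, h, hx, neg_one_mul]
  exact add_comm _ _

theorem commute_anticommutator_left {R : Type*} [Ring R] {J x : R} (hJ : J * J = -1) :
    Commute (J * x + x * J) J :=
  add_comm (x * J) _ ▸ commute_anticommutator_right hJ

variable {V : Type u} [NormedAddCommGroup V] [InnerProductSpace ℝ V]
  {J x A : V →L[ℝ] V} {k : ℕ}

theorem commute_polyQ (a : Fin (k + 1) → (V →L[ℝ] V) → ℝ) (h : Commute (J * x + x * J) A) :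
    Commute (polyQ J a x) A :=
  Commute.sum_left _ _ _ fun _ _ => (h.pow_left _).smul_left _

variable [FiniteDimensional ℝ V]

theorem star_polyQ (hJ : J ∈ twistorSpace V) (hx : x ∈ twistorSpace V)
    (a : Fin (k + 1) → (V →L[ℝ] V) → ℝ) : star (polyQ J a x) = polyQ J a x := by
  have h : star (J * x + x * J) = J * x + x * J := by
    simp [star_mul, (mem_twistorSpace_iff.1 hJ).2, (mem_twistorSpace_iff.1 hx).2, add_comm]
  simp [polyQ, star_sum, star_smul, star_pow, h]

/-- The algebraic relations at `x` between `J`, `x` and the value `F` of a field `Q S`. The first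
one makes `Ker F` and `Im F` orthogonal complements, the next two make them invariant under `x` and
`J`, and the commutation with `{J, x}` makes the relations pass from `S` to `Q S`. -/
structure FieldRelations (J x F : V →L[ℝ] V) : Prop where
  star_eq : star F = F ∨ star F = -F
  mul_self_right : ∃ Z : V →L[ℝ] V, Commute (J * x + x * J) Z ∧ F * x = Z * F
  mul_base_right : ∃ Z : V →L[ℝ] V, Commute (J * x + x * J) Z ∧ F * J = Z * F
  comm : Commute (J * x + x * J) F

theorem FieldRelations.of_mem_admissibleS (hJ : J ∈ twistorSpace V) (hx : x ∈ twistorSpace V)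
    {S : (V →L[ℝ] V) → (V →L[ℝ] V)} (hS : S ∈ admissibleS J) : FieldRelations J x (S x) := by
  obtain ⟨J1, J2⟩ := mem_twistorSpace_iff.1 hJ
  obtain ⟨x1, x2⟩ := mem_twistorSpace_iff.1 hx
  have cJ : Commute (J * x + x * J) J := commute_anticommutator_left J1
  have cx : Commute (J * x + x * J) x := commute_anticommutator_right x1
  have ex : ∀ y : V →L[ℝ] V, y * x * x = -y := fun y => by rw [mul_assoc, x1, mul_neg_one]
  have eJ : ∀ y : V →L[ℝ] V, y * J * J = -y := fun y => by rw [mul_assoc, J1, mul_neg_one]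
  rcases hS with rfl | rfl | rfl | rfl
  · exact ⟨by simp, ⟨x, cx, by simp⟩, ⟨J, cJ, by simp⟩, Commute.one_right _⟩
  · refine ⟨Or.inr (by simp [J2, x2, add_comm]), ⟨J, cJ, ?_⟩, ⟨x, cx, ?_⟩, cJ.add_right cx⟩ <;>
      simp only [add_mul, mul_add, x1, J1] <;> abel
  · refine ⟨Or.inr (by rw [star_sub, J2, x2, neg_sub_neg, neg_sub]), ⟨-J, cJ.neg_right, ?_⟩,
      ⟨-x, cx.neg_right, ?_⟩, cJ.sub_right cx⟩ <;>
      simp only [sub_mul, mul_sub, x1, J1, neg_mul] <;> noncomm_ring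
  · refine ⟨Or.inr (by simp [J2, x2, star_mul]), ⟨-x, cx.neg_right, ?_⟩, ⟨-J, cJ.neg_right, ?_⟩,
      (cJ.mul_right cx).sub_right (cx.mul_right cJ)⟩ <;>
      simp only [sub_mul, mul_sub, ← mul_assoc, ex, eJ, x1, J1, neg_mul] <;> noncomm_ring

namespace FieldRelations

variable {F : V →L[ℝ] V}

theorem polyQ_mul (hJ : J ∈ twistorSpace V) (hx : x ∈ twistorSpace V) (h : FieldRelations J x F)
    (a : Fin (k + 1) → (V →L[ℝ] V) → ℝ) : FieldRelations J x (polyQ J a x * F) := by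
  have hQ : Commute (J * x + x * J) (polyQ J a x) := (commute_polyQ a (Commute.refl _)).symm
  have hQF := commute_polyQ a h.comm
  have hmul : ∀ y : V →L[ℝ] V, (∃ Z, Commute (J * x + x * J) Z ∧ F * y = Z * F) →
      ∃ Z, Commute (J * x + x * J) Z ∧ polyQ J a x * F * y = Z * (polyQ J a x * F) := by
    rintro y ⟨Z, hZ, hy⟩
    exact ⟨Z, hZ, by rw [mul_assoc, hy, ← mul_assoc, (commute_polyQ a hZ).eq, mul_assoc]⟩
  refine ⟨?_, hmul x h.mul_self_right, hmul J h.mul_base_right, hQ.mul_right h.comm⟩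
  rw [star_mul, star_polyQ hJ hx, hQF.eq]
  exact h.star_eq.imp (fun hF => by rw [hF]) fun hF => by rw [hF, neg_mul]

theorem apply_self_mem_ker (h : FieldRelations J x F) {v : V} (hv : v ∈ F.ker) : x v ∈ F.ker := by
  obtain ⟨Z, -, hZ⟩ := h.mul_self_right
  have hv0 : F v = 0 := hv
  simpa [hv0] using congrArg (fun T : V →L[ℝ] V => T v) hZ

theorem apply_base_mem_ker (h : FieldRelations J x F) {v : V} (hv : v ∈ F.ker) : J v ∈ F.ker := by
  obtain ⟨Z, -, hZ⟩ := h.mul_base_right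
  have hv0 : F v = 0 := hv
  simpa [hv0] using congrArg (fun T : V →L[ℝ] V => T v) hZ

theorem orthogonal_ker (h : FieldRelations J x F) : F.kerᗮ = F.range := by
  have hker : (star F).ker = F.ker := by
    rcases h.star_eq with h | h <;> rw [h]
    exact LinearMap.ker_neg _
  rw [← hker, ContinuousLinearMap.star_eq_adjoint, ← ContinuousLinearMap.orthogonal_range,
    Submodule.orthogonal_orthogonal]

end FieldRelations

theorem isSplittingField_of_fieldRelations {F : (V →L[ℝ] V) → (V →L[ℝ] V)}
    (h : ∀ x ∈ twistorSpace V, FieldRelations J x (F x)) : IsSplittingField F where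
  orthogonal_ker x hx := (h x hx).orthogonal_ker
  apply_mem_ker x hx _ hv := (h x hx).apply_self_mem_ker hv

end Relations

section QSField

variable {V : Type u} [NormedAddCommGroup V] [InnerProductSpace ℝ V]

/-- The field of endomorphisms `Q S`. -/
def qsField (J : V →L[ℝ] V) {k : ℕ} (a : Fin (k + 1) → (V →L[ℝ] V) → ℝ)
    (S : (V →L[ℝ] V) → (V →L[ℝ] V)) (x : V →L[ℝ] V) : V →L[ℝ] V :=
  polyQ J a x * S x

/-- The field `Q S` with the coefficients of `Q` frozen to their values at `p`. -/
def frozenField (J : V →L[ℝ] V) {k : ℕ} (a : Fin (k + 1) → (V →L[ℝ] V) → ℝ)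
    (S : (V →L[ℝ] V) → (V →L[ℝ] V)) (p : V →L[ℝ] V) : (V →L[ℝ] V) → (V →L[ℝ] V) :=
  qsField J (fun i _ => a i p) S

/-- The pairs `(A, B)` of endomorphisms that restrict to the same endomorphism of `M`. -/
def agreeingPairs (M : Submodule ℝ V) : Subalgebra ℝ ((V →L[ℝ] V) × (V →L[ℝ] V)) where
  carrier := {A | ∀ v ∈ M, A.1 v = A.2 v ∧ A.2 v ∈ M}
  mul_mem' := fun {A B} hA hB v hv => by
    simpa [(hB v hv).1] using hA _ (hB v hv).2
  add_mem' := fun {A B} hA hB v hv => by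
    simpa [(hA v hv).1, (hB v hv).1] using M.add_mem (hA v hv).2 (hB v hv).2
  algebraMap_mem' := fun r v hv => by
    simpa [Algebra.algebraMap_eq_smul_one] using M.smul_mem r hv

variable {J p x y : V →L[ℝ] V} {S : (V →L[ℝ] V) → (V →L[ℝ] V)} {k : ℕ}
  {a : Fin (k + 1) → (V →L[ℝ] V) → ℝ} {M : Submodule ℝ V}

theorem frozenField_mem_agreeingPairs (hS : S ∈ admissibleS J)
    (hJM : (J, J) ∈ agreeingPairs M) (hM : (y, x) ∈ agreeingPairs M) :
    (frozenField J a S p y, frozenField J a S p x) ∈ agreeingPairs M := by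
  have hSM : (S y, S x) ∈ agreeingPairs M := by
    rcases hS with rfl | rfl | rfl | rfl
    · exact one_mem _
    · exact add_mem hJM hM
    · exact sub_mem hJM hM
    · exact sub_mem (mul_mem hJM hM) (mul_mem hM hJM)
  have hQM := sum_mem (t := Finset.univ) fun (i : Fin (k + 1)) _ => Subalgebra.smul_mem _
    (pow_mem (add_mem (mul_mem hJM hM) (mul_mem hM hJM)) (i : ℕ)) (a i p)
  convert mul_mem hQM hSM using 1
  ext1 <;> simp [frozenField, qsField, polyQ, Prod.fst_sum, Prod.snd_sum]

theorem contDiff_frozenField (hS : S ∈ admissibleS J) : ContDiff ℝ 1 (frozenField J a S p) := by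
  have hS' : ContDiff ℝ 1 S := by rcases hS with rfl | rfl | rfl | rfl <;> fun_prop
  have hQ : ContDiff ℝ 1 (polyQ J fun i _ => a i p) :=
    ContDiff.sum fun i _ => ContDiff.const_smul (a i p) (ContDiff.pow (by fun_prop) _)
  exact hQ.mul hS'

theorem qsField_eq_frozenField_of_tangent
    (ha : ∀ i, DifferentiableOn ℝ (a i) (twistorSpace V))
    (hint : ∀ i, ∀ L ∈ twistorSpace V, ∀ B ∈ distribution S L,
      fderivWithin ℝ (a i) (twistorSpace V) L B = 0)
    {H : Type*} [NormedAddCommGroup H] [NormedSpace ℝ H] {U : Set H} {h : H → V →L[ℝ] V}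
    {h' : H → H →L[ℝ] V →L[ℝ] V} (hU : IsOpen U) (hU' : IsPreconnected U)
    (hh : ∀ u ∈ U, HasFDerivAt h (h' u) u) (hT : ∀ u ∈ U, h u ∈ twistorSpace V)
    (hD : ∀ u ∈ U, ∀ w, h' u w ∈ distribution S (h u)) {u u₀ : H} (hu : u ∈ U) (hu₀ : u₀ ∈ U) :
    qsField J a S (h u) = frozenField J a S (h u₀) (h u) := by
  have hconst : ∀ i, a i (h u) = a i (h u₀) := fun i =>
    eq_of_fderivWithin_eq_zero (ha i) (hint i) hU hU' hh hT hD hu hu₀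
  simp only [frozenField, qsField, polyQ, hconst]

variable [FiniteDimensional ℝ V]

theorem fieldRelations_qsField (hJ : J ∈ twistorSpace V) (hS : S ∈ admissibleS J)
    (a : Fin (k + 1) → (V →L[ℝ] V) → ℝ) (hx : x ∈ twistorSpace V) :
    FieldRelations J x (qsField J a S x) :=
  (FieldRelations.of_mem_admissibleS hJ hx hS).polyQ_mul hJ hx a

theorem isSplittingField_qsField (hJ : J ∈ twistorSpace V) (hS : S ∈ admissibleS J)
    (a : Fin (k + 1) → (V →L[ℝ] V) → ℝ) : IsSplittingField (qsField J a S) :=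
  isSplittingField_of_fieldRelations fun _ hx => fieldRelations_qsField hJ hS a hx

theorem isSplittingField_frozenField (hJ : J ∈ twistorSpace V) (hS : S ∈ admissibleS J) :
    IsSplittingField (frozenField J a S p) :=
  isSplittingField_qsField hJ hS _

theorem isKernelStable_frozenField (hJ : J ∈ twistorSpace V) (hS : S ∈ admissibleS J) :
    IsKernelStable (frozenField J a S p) := by
  intro x hx y hy v hv
  have hrel : FieldRelations J x (frozenField J a S p x) := fieldRelations_qsField hJ hS _ hx
  have hagree := frozenField_mem_agreeingPairs (a := a) (p := p) hS
    (fun w hw => ⟨rfl, hrel.apply_base_mem_ker hw⟩)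
    (fun w hw => ⟨hy w hw, hrel.apply_self_mem_ker hw⟩) v hv
  exact hagree.1.trans hv

theorem distribution_qsField_le (hJ : J ∈ twistorSpace V) (hS : S ∈ admissibleS J)
    (a : Fin (k + 1) → (V →L[ℝ] V) → ℝ) (hx : x ∈ twistorSpace V) :
    distribution (qsField J a S) x ≤ distribution S x := by
  have hSs : IsSplittingField S :=
    isSplittingField_of_fieldRelations fun _ hx => FieldRelations.of_mem_admissibleS hJ hx hS
  rw [distribution_eq_skewAntiOn (isSplittingField_qsField hJ hS a) hx,
    distribution_eq_skewAntiOn hSs hx]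
  exact fun B hB => ⟨hB.1, fun v hv => hB.2 v (LinearMap.ker_le_ker_comp _ _ hv)⟩

theorem hasCayleyPlaques_qsField (hJ : J ∈ twistorSpace V) (hS : S ∈ admissibleS J)
    (ha : ∀ i, DifferentiableOn ℝ (a i) (twistorSpace V))
    (hint : ∀ i, ∀ L ∈ twistorSpace V, ∀ B ∈ distribution S L,
      fderivWithin ℝ (a i) (twistorSpace V) L B = 0) : HasCayleyPlaques (qsField J a S) := by
  intro p hp
  let G := frozenField J a S p
  have hG : IsSplittingField G := isSplittingField_frozenField hJ hS
  obtain ⟨ε, hε, hball⟩ := Metric.eventually_nhds_iff_ball.1 <|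
    hasCayleyPlaques_of_isKernelStable hG (isKernelStable_frozenField hJ hS)
      (contDiff_frozenField hS).continuous p hp
  have hleaf : ∀ A : distribution G p, A ∈ Metric.ball 0 ε → cayley p A ∈ leafSet G p :=
    fun A hA => hball A (by simpa using hA) A.2
  have hT : ∀ A : distribution G p, cayley p A ∈ twistorSpace V := fun A =>
    cayley_mem_twistorSpace hp A.2.1
  have hder : ∀ A : distribution G p, HasFDerivAt (fun A : distribution G p => cayley p A)
      ((cayleyDeriv p A).comp (distribution G p).subtypeL) A := fun A =>
    (hasFDerivAt_cayley (isUnit_one_add_of_mem_skewAnti A.2.1)).comp A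
      (distribution G p).subtypeL.hasFDerivAt
  have htangent : ∀ A : distribution G p, A ∈ Metric.ball 0 ε → ∀ w,
      (cayleyDeriv p A).comp (distribution G p).subtypeL w ∈ distribution S (cayley p A) := by
    intro A hA w
    refine distribution_qsField_le hJ hS (fun i _ => a i p) (hT A) ?_
    change _ ∈ distribution G (cayley p A)
    rw [distribution_eq_skewAntiOn hG (hT A), ((mem_leafSet_iff hG hp).1 (hleaf A hA)).2.2]
    refine mem_skewAntiOn_of_hasFDerivAt (hder A) (.of_forall hT) (.of_forall fun B v hv => ?_) w
    rw [cayley_apply_of_apply_eq_zero B.2.1 (B.2.2.1 v hv),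
      cayley_apply_of_apply_eq_zero A.2.1 (A.2.2.1 v hv)]
  filter_upwards [Metric.ball_mem_nhds 0 hε] with A hA hAD
  have hcoef := qsField_eq_frozenField_of_tangent (J := J) ha hint Metric.isOpen_ball
    (convex_ball (0 : distribution G p) ε).isPreconnected (fun A _ => hder A) (fun A _ => hT A)
    htangent (u := ⟨A, hAD⟩) (by simpa using hA) (Metric.mem_ball_self hε)
  simp only [Submodule.coe_zero, cayley_zero] at hcoef
  exact (mem_leafSet_congr (F := qsField J a S) (G := G) rfl hcoef).2 (hball A hA hAD)

theorem trapsIntegralMaps_qsField (hJ : J ∈ twistorSpace V) (hS : S ∈ admissibleS J)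
    (ha : ∀ i, DifferentiableOn ℝ (a i) (twistorSpace V))
    (hint : ∀ i, ∀ L ∈ twistorSpace V, ∀ B ∈ distribution S L,
      fderivWithin ℝ (a i) (twistorSpace V) L B = 0) : TrapsIntegralMaps (qsField J a S) := by
  intro d h u₀ hh hT hD hfin
  have hcoef : ∀ᶠ u in 𝓝 u₀, qsField J a S (h u) = frozenField J a S (h u₀) (h u) := by
    obtain ⟨r, hr, hball⟩ := Metric.eventually_nhds_iff_ball.1
      ((hh.eventually (by simp)).and (hT.and hD))
    filter_upwards [Metric.ball_mem_nhds u₀ hr] with u hu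
    exact qsField_eq_frozenField_of_tangent ha hint Metric.isOpen_ball
      (convex_ball u₀ r).isPreconnected
      (fun u hu => ((hball u hu).1.differentiableAt one_ne_zero).hasFDerivAt)
      (fun u hu => (hball u hu).2.1) (fun u hu w => distribution_qsField_le hJ hS a
        (hball u hu).2.1 ((hball u hu).2.2 w)) hu (Metric.mem_ball_self hr)
  have hdist : ∀ᶠ u in 𝓝 u₀, distribution (qsField J a S) (h u) =
      distribution (frozenField J a S (h u₀)) (h u) := hcoef.mono fun u hu => distribution_congr hu
  have hleaf := eventually_mem_leafSet (isSplittingField_frozenField hJ hS)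
    (isKernelStable_frozenField hJ hS) (contDiff_frozenField hS) hh hT
    (hdist.mp (hD.mono fun u hu he => he ▸ hu))
    (hdist.mp (hfin.mono fun u hu he => by rw [← he, hu, hdist.self_of_nhds]))
  filter_upwards [hleaf, hcoef] with u hu hcu
  exact (mem_leafSet_congr (F := qsField J a S) (G := frozenField J a S (h u₀)) rfl hcu).2 hu

end QSField

end

end Twistor

theorem theorem6p1_general {V : Type u} [NormedAddCommGroup V] [InnerProductSpace ℝ V]
    [FiniteDimensional ℝ V] {J : V →L[ℝ] V} (hJ : J ∈ Twistor.twistorSpace V)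
    {S : (V →L[ℝ] V) → (V →L[ℝ] V)} (hS : S ∈ Twistor.admissibleS J)
    {k : ℕ} {a : Fin (k + 1) → (V →L[ℝ] V) → ℝ}
    (ha : ∀ i, DifferentiableOn ℝ (a i) (Twistor.twistorSpace V))
    (hint : ∀ i, ∀ L ∈ Twistor.twistorSpace V, ∀ B ∈ Twistor.distribution S L,
      fderivWithin ℝ (a i) (Twistor.twistorSpace V) L B = 0)
    {K : V →L[ℝ] V} (hK : K ∈ Twistor.twistorSpace V) :
    Twistor.IsLeaf (Twistor.twistorSpace V) (Twistor.distribution (Twistor.qsField J a S)) K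
        (connectedComponentIn (Twistor.leafSet (Twistor.qsField J a S) K) K) ∧
      Twistor.IsComplexSubmanifold
        (connectedComponentIn (Twistor.leafSet (Twistor.qsField J a S) K) K) := by
  have hsplit := Twistor.isSplittingField_qsField hJ hS a
  have hplaques := Twistor.hasCayleyPlaques_qsField hJ hS ha hint
  have htraps := Twistor.trapsIntegralMaps_qsField hJ hS ha hint
  refine ⟨⟨?_, ?_, fun Y hY hne => ?_⟩, ?_⟩
  · exact Twistor.isConnectedIntegralManifold_component hsplit hplaques hK
  · exact mem_connectedComponentIn (Twistor.self_mem_leafSet hsplit hK)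
  · exact Twistor.isConnectedIntegralManifold_subset_component hsplit htraps hK hY hne
  · exact Twistor.isComplexSubmanifold_component hsplit hplaques hK

/- For `a` smooth on `T(V)` and `B` tangent to `T(V)` at `L`, the number
`fderivWithin ℝ a (twistorSpace V) L B` is the derivative of `a` along `B`: all derivatives of `a`
within `T(V)` agree on tangent vectors. -/
theorem theorem6p1 {V : Type u} [NormedAddCommGroup V] [InnerProductSpace ℝ V]
    [FiniteDimensional ℝ V]
    (J : V →L[ℝ] V) (hJ : J ∈ Twistor.twistorSpace V)
    (S : (V →L[ℝ] V) → (V →L[ℝ] V)) (hS : S ∈ Twistor.admissibleS J)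
    (k : ℕ) (a : Fin (k + 1) → (V →L[ℝ] V) → ℝ)
    (ha : ∀ i, ContDiffOn ℝ ∞ (a i) (Twistor.twistorSpace V))
    (hint : ∀ i, ∀ L ∈ Twistor.twistorSpace V, ∀ B ∈ Twistor.distribution S L,
      fderivWithin ℝ (a i) (Twistor.twistorSpace V) L B = 0)
    (QS : (V →L[ℝ] V) → (V →L[ℝ] V)) (hQS : QS = fun L => Twistor.polyQ J a L * S L)
    (K : V →L[ℝ] V) (hK : K ∈ Twistor.twistorSpace V) :
    Twistor.IsLeaf (Twistor.twistorSpace V) (Twistor.distribution QS) K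
        (connectedComponentIn (Twistor.leafSet QS K) K) ∧
      Twistor.IsComplexSubmanifold (connectedComponentIn (Twistor.leafSet QS K) K) := by
  subst hQS
  exact theorem6p1_general hJ hS (fun i => (ha i).differentiableOn (by simp)) hint hK
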